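/- **Setting.** Let $R:\mathbb R^{n_y}\times\mathbb R^n\to\mathbb R^m$ and $c:\mathbb R^{n_y}\times\mathbb R^n\to\mathbb R^p$, with $c$ continuously differentiable, and suppose that for every $u$ the equation $c(y,u)=0$ has a unique solution $y(u)$, that the partial Jacobian $c_y$ is invertible at $(y(u),u)$, and that $R$ is differentiable at $(y(u),u)$ with partial Jacobians $G_y,G_u$. Put $\hat R(u)=R(y(u),u)$, $\hat J(u)=\frac12\|\hat R(u)\|^2$ and, with all Jacobians taken at $(y(u),u)$, $\hat G(u)=G_u-G_y\,c_y^{-1}c_u$. Assume that $\hat J$ is continuously differentiable with $L$-Lipschitz gradient, $L>0$. **Algorithm.** Let $\eta\in(0,1)$, $0<\gamma_{\min}\le\gamma_0$, $\theta\in[0,1)$, $u_0\in\mathbb R^n$. At iteration $k$ put $g_k=\hat G(u_k)^{\mathrm T}\hat R(u_k)$ and let $H_k\in\mathbb R^{n\times n}$ be symmetric positive semidefinite with $\|H_k\|\le M_H$, where $M_H>0$. The step $s_k$ is the first iterate of the conjugate gradient method, started at $0$ and applied to $(H_k+\gamma_kI)s=-g_k$, that satisfies $$\|(H_k+\gamma_kI)s_k+g_k\|\le\theta\sqrt{\frac{\gamma_k}{\|H_k\|+\gamma_k}}\,\|g_k\|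 .\qquad(1)$$ Each conjugate gradient iteration costs one matrix-vector product. With $m_k(u_k+s)=\frac12\|\hat R(u_k)\|^2+g_k^{\mathrm T}s+\frac12s^{\mathrm T}(H_k+\gamma_kI)s$, if $$\frac{\hat J(u_k)-\hat J(u_k+s_k)}{m_k(u_k)-m_k(u_k+s_k)}\ge\eta$$ then $u_{k+1}=u_k+s_k$ and $\gamma_{k+1}=\max\{\frac12\gamma_k,\gamma_{\min}\}$; otherwise $u_{k+1}=u_k$ and $\gamma_{k+1}=2\gamma_k$. Iteration $k$ is successful if $u_{k+1}\ne u_k$. For $\epsilon_R>0$ and $\epsilon_g\in(0,1)$, call $u$ an $(\epsilon_R,\epsilon_g)$-point if $\|\hat R(u)\|\le\epsilon_R$ or $\|\hat G(u)^{\mathrm T}\hat R(u)\|/\|\hat R(u)\|\le\epsilon_g$. Let $\mathcal S$ (resp. $\mathcal U$) be the set of successful (resp. unsuccessful) iterations $k$ for which $u_k$ is not an $(\epsilon_R,\epsilon_g)$-point. Put $$\gamma_{\max}^{in}=\max\Big\{1,\gamma_0,\tfrac{L(1+\theta)^2}{(1-\eta)(1-\theta^2)}\Big\},\qquad \kappa=\frac{M_H+\gamma_{\max}^{in}}{\gamma_{\min}},\qquad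 N=\min\Big\{n,\Big\lceil\tfrac12\sqrt\kappa\,\log\tfrac{2\kappa}{\theta}\Big\rceil\Big\},$$ where $N=n$ if $\theta=0$. **Statement.** The sets $\mathcal S$ and $\mathcal U$ are finite and the algorithm reaches an $(\epsilon_R,\epsilon_g)$-point. Until the first such point, conjugate gradient finds a step satisfying (1) within $N$ products at every iteration; the products spent in successful iterations number at most $N\,(1+|\mathcal S|)$, and all matrix-vector products together number at most $$N\,\bigl(1+|\mathcal S|+|\mathcal U|\bigr)=\mathcal O\!\left(\min\Big\{n,\sqrt\kappa\,\log\frac{\kappa}{\theta}\Big\}\,\log\Big(\frac1{1-\theta^2}\Big)\,\frac1{(1-\theta^2)^{2}}\,\log(\epsilon_R^{-1})\,\epsilon_g^{-2}\right).$$ Here $\mathcal O$ means: given $\theta_0,\bar\epsilon\in(0,1)$ and an upper bound $J_0$ on $\hat J(u_0)$, there is a constant depending only on $L,M_H,\eta,\gamma_0,\gamma_{\min},J_0,\theta_0,\bar\epsilon$ (in particular not on the dimensions, the problem, $\theta$, $\epsilon_R$, $\epsilon_g$ or the matrices $H_k$) with which the bound holds for all $\theta\in[\theta_0,1)$, $\epsilon_R\in(0,\bar\epsilon]$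 and $\epsilon_g\in(0,1)$. -/

import Mathlib

open scoped BigOperators

noncomputable section

/-- `ℝᵈ` with the Euclidean norm. -/
abbrev Euc (d : ℕ) : Type := EuclideanSpace ℝ (Fin d)

/-! ### Conjugate gradient -/

section ConjugateGradient

variable {E : Type*} [NormedAddCommGroup E] [InnerProductSpace ℝ E]

/-- State of the conjugate gradient method: iterate, residual, search direction. -/
structure CGState (E : Type*) where
  x : E
  r : E
  d : E

/-- One conjugate gradient iteration for `A x = b`. It uses exactly one product with `A`,
namely `w = A d`. -/
def cgStep (A : E →L[ℝ] E) (z : CGState E) : CGState E :=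
  let w : E := A z.d
  let α : ℝ := ‖z.r‖ ^ 2 / inner ℝ z.d w
  let r' : E := z.r - α • w
  let β : ℝ := ‖r'‖ ^ 2 / ‖z.r‖ ^ 2
  { x := z.x + α • z.d, r := r', d := r' + β • z.d }

/-- The state after `q` iterations, started at `x = 0` (residual and direction equal to `b`). -/
def cgState (A : E →L[ℝ] E) (b : E) : ℕ → CGState E
  | 0 => { x := 0, r := b, d := b }
  | q + 1 => cgStep A (cgState A b q)

/-- The `q`-th conjugate gradient iterate for `A x = b`. -/
def cgIterate (A : E →L[ℝ] E) (b : E) (q : ℕ) : E := (cgState A b q).x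

/-- The inexactness condition on a step `s`, with `t = (H + γ I) s + g`:
`‖t‖ ≤ θ √(γ / (‖H‖ + γ)) ‖g‖`. -/
def IsInexactStep (θ γ : ℝ) (H : E →L[ℝ] E) (g s : E) : Prop :=
  ‖(H + γ • ContinuousLinearMap.id ℝ E) s + g‖ ≤ θ * √(γ / (‖H‖ + γ)) * ‖g‖

/-- Number of conjugate gradient iterations (equivalently, of matrix-vector products) performed
on `(H + γ I) s = -g` until the first iterate that satisfies the inexactness condition. -/
def cgCount (θ γ : ℝ) (H : E →L[ℝ] E) (g : E) : ℕ :=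
  sInf {q : ℕ | IsInexactStep θ γ H g
    (cgIterate (H + γ • ContinuousLinearMap.id ℝ E) (-g) q)}

/-- The step returned by conjugate gradient: its first iterate satisfying the inexactness
condition. -/
def cgInexactStep (θ γ : ℝ) (H : E →L[ℝ] E) (g : E) : E :=
  cgIterate (H + γ • ContinuousLinearMap.id ℝ E) (-g) (cgCount θ γ H g)

end ConjugateGradient

/-! ### Implicitly constrained least squares -/

/-- Data of the problem `min ½ ‖R(y,u)‖²` subject to `c(y,u) = 0`, together with the
solution map `u ↦ y(u)` of the constraint. -/
structure ImplicitLS (ny n m p : ℕ) where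
  R : Euc ny × Euc n → Euc m
  c : Euc ny × Euc n → Euc p
  y : Euc n → Euc ny

namespace ImplicitLS

variable {ny n m p : ℕ} (P : ImplicitLS ny n m p)

/-- Jacobian of `c` with respect to `y` at `(y(u), u)`. -/
def cy (u : Euc n) : Euc ny →L[ℝ] Euc p := fderiv ℝ (fun v => P.c (v, u)) (P.y u)

/-- Jacobian of `c` with respect to `u` at `(y(u), u)`. -/
def cu (u : Euc n) : Euc n →L[ℝ] Euc p := fderiv ℝ (fun w => P.c (P.y u, w)) u

/-- Jacobian of `R` with respect to `y` at `(y(u), u)`. -/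
def Gy (u : Euc n) : Euc ny →L[ℝ] Euc m := fderiv ℝ (fun v => P.R (v, u)) (P.y u)

/-- Jacobian of `R` with respect to `u` at `(y(u), u)`. -/
def Gu (u : Euc n) : Euc n →L[ℝ] Euc m := fderiv ℝ (fun w => P.R (P.y u, w)) u

/-- The standing requirements on the problem: `y(u)` is the unique solution of `c(·,u) = 0`,
`c` is continuously differentiable, `c_y` is invertible on the feasible set, and the Jacobians
of `R` exist there. -/
structure WellPosed : Prop where
  solution : ∀ u v, P.c (v, u) = 0 ↔ v = P.y u
  contDiff_c : ContDiff ℝ 1 P.c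
  invertible_cy : ∀ u, (P.cy u).IsInvertible
  differentiable_R : ∀ u, DifferentiableAt ℝ P.R (P.y u, u)

/-- Reduced residual `R̂(u) = R(y(u),u)`. -/
def Rhat (u : Euc n) : Euc m := P.R (P.y u, u)

/-- Reduced objective `Ĵ(u) = ½ ‖R̂(u)‖²`. -/
def Jhat (u : Euc n) : ℝ := 1 / 2 * ‖P.Rhat u‖ ^ 2

/-- The adjoint formula `Ĝ(u) = G_u - G_y c_y⁻¹ c_u`. -/
def Ghat (u : Euc n) : Euc n →L[ℝ] Euc m :=
  P.Gu u - (P.Gy u).comp ((P.cy u).inverse.comp (P.cu u))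

/-- `Ĝ(u)ᵀ R̂(u)`. -/
def grad (u : Euc n) : Euc n := ContinuousLinearMap.adjoint (P.Ghat u) (P.Rhat u)

/-- `Ĵ` is continuously differentiable and its gradient is `L`-Lipschitz. -/
def LipschitzGradient (L : ℝ) : Prop :=
  ContDiff ℝ 1 P.Jhat ∧
    ∀ v w : Euc n, ‖gradient P.Jhat v - gradient P.Jhat w‖ ≤ L * ‖v - w‖

/-- Approximate stationarity: `‖R̂(u)‖ ≤ ε_R` or `‖Ĝ(u)ᵀR̂(u)‖ / ‖R̂(u)‖ ≤ ε_g`. -/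
def IsEpsPoint (εR εg : ℝ) (u : Euc n) : Prop :=
  ‖P.Rhat u‖ ≤ εR ∨ ‖P.grad u‖ / ‖P.Rhat u‖ ≤ εg

/-- The quadratic model at `u`, as a function of the step `s`. -/
def model (u : Euc n) (H : Euc n →L[ℝ] Euc n) (γ : ℝ) (s : Euc n) : ℝ :=
  1 / 2 * ‖P.Rhat u‖ ^ 2 + inner ℝ (P.grad u) s +
    1 / 2 * inner ℝ s ((H + γ • ContinuousLinearMap.id ℝ (Euc n)) s)

/-- Ratio of actual to predicted decrease. -/
def ratio (u : Euc n) (H : Euc n →L[ℝ] Euc n) (γ : ℝ) (s : Euc n) : ℝ :=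
  (P.Jhat u - P.Jhat (u + s)) / (P.model u H γ 0 - P.model u H γ s)

/-- The step computed by conjugate gradient at `u`, for the matrix `H` and parameter `γ`. -/
def step (θ : ℝ) (u : Euc n) (H : Euc n →L[ℝ] Euc n) (γ : ℝ) : Euc n :=
  cgInexactStep θ γ H (P.grad u)

/-- `(u_k, γ_k)` are the iterates and parameters produced by the regularization method from
`(u₀, γ₀)` with the matrices `H_k`, steps being computed by conjugate gradient. -/
structure IsRun (η θ γmin γ0 : ℝ) (u0 : Euc n) (H : ℕ → (Euc n →L[ℝ] Euc n))
    (u : ℕ → Euc n) (γ : ℕ → ℝ) : Prop where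
  u_zero : u 0 = u0
  γ_zero : γ 0 = γ0
  accept : ∀ k, η ≤ P.ratio (u k) (H k) (γ k) (P.step θ (u k) (H k) (γ k)) →
    u (k + 1) = u k + P.step θ (u k) (H k) (γ k) ∧ γ (k + 1) = max (0.5 * γ k) γmin
  reject : ∀ k, ¬ η ≤ P.ratio (u k) (H k) (γ k) (P.step θ (u k) (H k) (γ k)) →
    u (k + 1) = u k ∧ γ (k + 1) = 2 * γ k

/-- Successful iterations (`u_{k+1} ≠ u_k`) at which `u_k` is not an approximate
stationary point. -/
def successes (εR εg : ℝ) (u : ℕ → Euc n) : Set ℕ :=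
  {k | u (k + 1) ≠ u k ∧ ¬ P.IsEpsPoint εR εg (u k)}

/-- Unsuccessful iterations (`u_{k+1} = u_k`) at which `u_k` is not an approximate
stationary point. -/
def failures (εR εg : ℝ) (u : ℕ → Euc n) : Set ℕ :=
  {k | u (k + 1) = u k ∧ ¬ P.IsEpsPoint εR εg (u k)}

/-- Matrix-vector products spent at iteration `k`. -/
def products (θ : ℝ) (H : ℕ → (Euc n →L[ℝ] Euc n)) (u : ℕ → Euc n) (γ : ℕ → ℝ) (k : ℕ) : ℕ :=
  cgCount θ (γ k) (H k) (P.grad (u k))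

end ImplicitLS

/-- `γ_max^in = max {1, γ₀, L (1+θ)² / ((1-η)(1-θ²))}`. -/
def gammaMaxIn (L η θ γ0 : ℝ) : ℝ :=
  max 1 (max γ0 (L * (1 + θ) ^ 2 / ((1 - η) * (1 - θ ^ 2))))

/-- `κ = (M_H + γ_max^in) / γ_min`. -/
def kappaIn (L MH η θ γ0 γmin : ℝ) : ℝ := (MH + gammaMaxIn L η θ γ0) / γmin

/-- The bound `min {n, ⌈½ √κ log (2κ/θ)⌉}` on the products of one conjugate gradient call
(read as `n` when `θ = 0`, where the second term is infinite). -/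
def cgBound (n : ℕ) (κ θ : ℝ) : ℕ :=
  if θ = 0 then n else min n ⌈1 / 2 * √κ * Real.log (2 * κ / θ)⌉₊

end

/-! ### Conjugate gradient: orthogonality, termination, optimality -/

section ConjugateGradientTheory

variable {E : Type*} [NormedAddCommGroup E] [InnerProductSpace ℝ E]

/-! Write A = H + γI, with residual t = As + g. Conjugate gradient is a Galerkin method
(`cgOrthogonal`): t is orthogonal to s, and s minimizes the energy of the error over a Krylov space.
Orthogonal residuals force termination within n products. Comparing with Chebyshev polynomials
(`energy_cgIterate_le_aeval`, `exists_polynomial_abs_le`) gives the √κ count.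

Galerkin orthogonality also gives ⟨s, As⟩ = ⟨g, A⁻¹g⟩ - ⟨t, A⁻¹t⟩. The weight in (1) makes the last
term at most θ²‖g‖²/(‖H‖+γ), so the predicted decrease, half of ⟨s, As⟩, is at least
(1-θ²)‖g‖²/(2(‖H‖+γ)) (`le_energy_cgInexactStep`).

By the descent lemma a step is accepted once γ ≥ L/(1-η) (`WellPosed.le_ratio`), so γ stays bounded
independently of θ while the gradient is nonzero. Off (ε_R, ε_g)-points ‖g‖² ≥ 2 ε_g² Ĵ, so each
success multiplies Ĵ by at most 1 - c, with c of order (1-θ²) ε_g² (`Jhat_succ_le_mul`). As Ĵ >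
ε_R²/2 there, |S| is of order c⁻¹ log(1/ε_R). A bounded number b of doublings from γ_min reaches the
acceptance threshold, so each failure has a success within b iterations and |U| ≤ (b+1)|S|
(`exists_add_mem_successes`).

The resulting rate is 1/(1-θ²). The stated one is weaker: for θ ≥ θ₀ the factor log(1/(1-θ²)) is
bounded below, and 1/(1-θ²) is at most its square (`iterations_le`). -/

/-- The span of the first `q` search directions of conjugate gradient. -/
def cgSpan (A : E →L[ℝ] E) (b : E) (q : ℕ) : Submodule ℝ E :=
  Submodule.span ℝ ((fun i => (cgState A b i).d) '' Set.Iio q)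

theorem cgSpan_mono (A : E →L[ℝ] E) (b : E) {q q' : ℕ} (h : q ≤ q') :
    cgSpan A b q ≤ cgSpan A b q' :=
  Submodule.span_mono (Set.image_mono (Set.Iio_subset_Iio h))

theorem cgState_d_mem_cgSpan (A : E →L[ℝ] E) (b : E) {i q : ℕ} (h : i < q) :
    (cgState A b i).d ∈ cgSpan A b q :=
  Submodule.subset_span ⟨i, h, rfl⟩

theorem cgState_d_succ (A : E →L[ℝ] E) (b : E) (q : ℕ) :
    (cgState A b (q + 1)).d = (cgState A b (q + 1)).r +
      (‖(cgState A b (q + 1)).r‖ ^ 2 / ‖(cgState A b q).r‖ ^ 2) • (cgState A b q).d := rfl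

theorem cgState_r_succ (A : E →L[ℝ] E) (b : E) (q : ℕ) :
    (cgState A b (q + 1)).r = (cgState A b q).r -
      (‖(cgState A b q).r‖ ^ 2 / inner ℝ (cgState A b q).d (A (cgState A b q).d)) •
        A (cgState A b q).d := rfl

theorem cgState_x_succ (A : E →L[ℝ] E) (b : E) (q : ℕ) :
    (cgState A b (q + 1)).x = (cgState A b q).x +
      (‖(cgState A b q).r‖ ^ 2 / inner ℝ (cgState A b q).d (A (cgState A b q).d)) •
        (cgState A b q).d := rfl

theorem cgState_d_eq_zero (A : E →L[ℝ] E) (b : E) {q : ℕ} (h : (cgState A b q).r = 0) :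
    (cgState A b q).d = 0 := by
  cases q with
  | zero => exact h
  | succ q => rw [cgState_d_succ, h]; simp

/-- A zero residual makes the numerator of the step length vanish, so the recurrence is stationary
after termination whatever its denominators are. -/
theorem cgState_r_eq_zero_of_le (A : E →L[ℝ] E) (b : E) {q q' : ℕ} (hq : q ≤ q')
    (h : (cgState A b q).r = 0) : (cgState A b q').r = 0 := by
  induction q', hq using Nat.le_induction with
  | base => exact h
  | succ k _ ih => rw [cgState_r_succ, ih]; simp

theorem cgState_r_eq (A : E →L[ℝ] E) (b : E) (q : ℕ) :
    (cgState A b q).r = b - A (cgState A b q).x := by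
  induction q with
  | zero => simp [cgState]
  | succ q ih => rw [cgState_r_succ, cgState_x_succ, map_add, map_smul, ih]; abel

theorem cgIterate_mem_cgSpan (A : E →L[ℝ] E) (b : E) (q : ℕ) :
    cgIterate A b q ∈ cgSpan A b q := by
  induction q with
  | zero => exact Submodule.zero_mem _
  | succ q ih =>
    exact Submodule.add_mem _ (cgSpan_mono A b q.le_succ ih)
      (Submodule.smul_mem _ _ (cgState_d_mem_cgSpan A b q.lt_succ_self))

theorem cgState_r_mem_cgSpan (A : E →L[ℝ] E) (b : E) (q : ℕ) :
    (cgState A b q).r ∈ cgSpan A b (q + 1) := by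
  cases q with
  | zero => exact cgState_d_mem_cgSpan A b Nat.zero_lt_one
  | succ q =>
    rw [eq_sub_of_add_eq (cgState_d_succ A b q).symm]
    exact Submodule.sub_mem _ (cgState_d_mem_cgSpan A b (by omega))
      (Submodule.smul_mem _ _ (cgState_d_mem_cgSpan A b (by omega)))

theorem inner_eq_zero_of_mem_cgSpan {A : E →L[ℝ] E} {b v w : E} {q : ℕ}
    (h : ∀ i < q, inner ℝ w (cgState A b i).d = 0) (hv : v ∈ cgSpan A b q) :
    inner ℝ w v = 0 := by
  induction hv using Submodule.span_induction with
  | mem x hx => obtain ⟨i, hi, rfl⟩ := hx; exact h i hi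
  | zero => simp
  | add x y _ _ hx hy => rw [inner_add_right, hx, hy, add_zero]
  | smul a x _ hx => rw [inner_smul_right, hx, mul_zero]

/-- Orthogonality relations of conjugate gradient after `q` iterations. -/
structure CGOrthogonal (A : E →L[ℝ] E) (b : E) (q : ℕ) : Prop where
  inner_r_d : ∀ i < q, inner ℝ (cgState A b q).r (cgState A b i).d = 0
  inner_d_map_d : ∀ i < q, inner ℝ (cgState A b q).d (A (cgState A b i).d) = 0
  inner_r_d_self : inner ℝ (cgState A b q).r (cgState A b q).d = ‖(cgState A b q).r‖ ^ 2

variable {A : E →L[ℝ] E} (hA : (A : E →ₗ[ℝ] E).IsSymmetric)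
  (hpos : ∀ v, v ≠ 0 → 0 < inner ℝ v (A v)) (b : E)

-- The residual recurrence solved for A d. Dividing by the step length is legitimate because ⟨r, d⟩
-- = ‖r‖² ≠ 0 excludes d = 0.
include hpos in
theorem CGOrthogonal.map_d_eq {b : E} {q : ℕ} (h : CGOrthogonal A b q)
    (hr : (cgState A b q).r ≠ 0) :
    0 < inner ℝ (cgState A b q).d (A (cgState A b q).d) ∧
    A (cgState A b q).d =
      (inner ℝ (cgState A b q).d (A (cgState A b q).d) / ‖(cgState A b q).r‖ ^ 2) •
        ((cgState A b q).r - (cgState A b (q + 1)).r) := by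
  have hd : (cgState A b q).d ≠ 0 := by
    intro hd
    have := h.inner_r_d_self
    rw [hd, inner_zero_right] at this
    exact hr (by simpa using this.symm)
  have h1 := hpos _ hd
  have h2 : ‖(cgState A b q).r‖ ≠ 0 := by simpa using hr
  refine ⟨h1, ?_⟩
  rw [cgState_r_succ, sub_sub_cancel, smul_smul, div_mul_div_cancel₀ (by positivity),
    div_self h1.ne', one_smul]

include hpos in
theorem CGOrthogonal.map_d_mem {b : E} {q : ℕ} (h : CGOrthogonal A b q) :
    A (cgState A b q).d ∈ cgSpan A b (q + 2) := by
  by_cases hr : (cgState A b q).r = 0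
  · rw [cgState_d_eq_zero A b hr, map_zero]; exact Submodule.zero_mem _
  · rw [(h.map_d_eq hpos hr).2]
    exact Submodule.smul_mem _ _ (Submodule.sub_mem _
      (cgSpan_mono A b (by omega) (cgState_r_mem_cgSpan A b q)) (cgState_r_mem_cgSpan A b (q + 1)))

-- Strong induction, since conjugacy to an old direction d_i uses the relations at i to place A d_i
-- in an earlier span. The step length α is what makes the new residual orthogonal to the last
-- direction, and β what makes the new direction conjugate to it.
include hA hpos in
theorem cgOrthogonal (q : ℕ) : CGOrthogonal A b q := by
  induction q using Nat.strong_induction_on with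
  | _ q ih =>
  cases q with
  | zero => exact ⟨by simp, by simp, by simp [cgState]⟩
  | succ q =>
  have hq := ih q q.lt_succ_self
  by_cases hr : (cgState A b q).r = 0
  · have hr' := cgState_r_eq_zero_of_le A b q.le_succ hr
    have hd' := cgState_d_eq_zero A b hr'
    exact ⟨by simp [hr'], by simp [hd'], by simp [hr']⟩
  obtain ⟨hdAd, hAd⟩ := hq.map_d_eq hpos hr
  have hrd : ∀ i < q + 1, inner ℝ (cgState A b (q + 1)).r (cgState A b i).d = 0 := by
    intro i hi
    have hsymm : inner ℝ (A (cgState A b q).d) (cgState A b i).d =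
        inner ℝ (cgState A b q).d (A (cgState A b i).d) := hA _ _
    rw [cgState_r_succ, inner_sub_left, inner_smul_left, hsymm]
    rcases Nat.lt_succ_iff_lt_or_eq.1 hi with hi | rfl
    · rw [hq.inner_r_d i hi, hq.inner_d_map_d i hi]; simp
    · rw [hq.inner_r_d_self]
      simp only [conj_trivial]
      rw [div_mul_cancel₀ _ hdAd.ne', sub_self]
  have horth : inner ℝ (cgState A b (q + 1)).r (cgState A b q).r = 0 :=
    inner_eq_zero_of_mem_cgSpan hrd (cgState_r_mem_cgSpan A b q)
  refine ⟨hrd, fun i hi => ?_, ?_⟩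
  · rw [cgState_d_succ, inner_add_left, inner_smul_left]
    simp only [conj_trivial]
    rcases Nat.lt_succ_iff_lt_or_eq.1 hi with hi | rfl
    -- For i < q, A d_i lies in the span of the first i + 2 ≤ q + 1 directions, to which the new
    -- residual is orthogonal.
    · rw [hq.inner_d_map_d i hi, inner_eq_zero_of_mem_cgSpan hrd
        (cgSpan_mono A b (by omega) ((ih i (by omega)).map_d_mem hpos))]
      simp
    · have h2 : ‖(cgState A b i).r‖ ≠ 0 := by simpa using hr
      -- Only the first summand is expanded: it becomes -β⟨d, Ad⟩ and cancels the second.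
      conv_lhs => enter [1]; rw [hAd]
      rw [inner_smul_right, inner_sub_right, horth, real_inner_self_eq_norm_sq]
      field_simp
      ring
  · rw [cgState_d_succ, inner_add_right, inner_smul_right, hrd q q.lt_succ_self,
      real_inner_self_eq_norm_sq]
    simp

include hA hpos in
theorem inner_cgState_r_eq_zero {v : E} {q : ℕ} (hv : v ∈ cgSpan A b q) :
    inner ℝ (cgState A b q).r v = 0 :=
  inner_eq_zero_of_mem_cgSpan (cgOrthogonal hA hpos b q).inner_r_d hv

include hA hpos in
theorem map_mem_cgSpan_succ {v : E} {q : ℕ} (hv : v ∈ cgSpan A b q) :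
    A v ∈ cgSpan A b (q + 1) := by
  induction hv using Submodule.span_induction with
  | mem x hx =>
    obtain ⟨i, hi, rfl⟩ := hx
    exact cgSpan_mono A b (Nat.succ_le_succ hi) ((cgOrthogonal hA hpos b i).map_d_mem hpos)
  | zero => simp
  | add x y _ _ hx hy => rw [map_add]; exact Submodule.add_mem _ hx hy
  | smul a x _ hx => rw [map_smul]; exact Submodule.smul_mem _ _ hx

-- Only this inclusion of the Krylov space is needed: it admits polynomials in A applied to b as
-- competitors in the energy minimization.
include hA hpos in
theorem pow_apply_mem_cgSpan (i : ℕ) :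
    ((A : E →ₗ[ℝ] E) ^ i) b ∈ cgSpan A b (i + 1) := by
  induction i with
  | zero => exact cgState_d_mem_cgSpan A b Nat.zero_lt_one
  | succ i ih =>
    rw [pow_succ']
    exact map_mem_cgSpan_succ hA hpos b ih

include hA hpos in
theorem aeval_apply_mem_cgSpan {w : Polynomial ℝ} {q : ℕ} (hw : w.natDegree < q) :
    Polynomial.aeval (A : E →ₗ[ℝ] E) w b ∈ cgSpan A b q := by
  rw [Polynomial.aeval_eq_sum_range' hw, LinearMap.sum_apply]
  exact Submodule.sum_mem _ fun i hi => Submodule.smul_mem _ _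
    (cgSpan_mono A b (Finset.mem_range.1 hi) (pow_apply_mem_cgSpan hA hpos b i))

include hA hpos in
/-- Conjugate gradient terminates after at most `dim E` iterations. -/
theorem cgState_r_finrank_eq_zero [FiniteDimensional ℝ E] :
    (cgState A b (Module.finrank ℝ E)).r = 0 := by
  by_contra hne
  have hne' : ∀ i : Fin (Module.finrank ℝ E + 1), (cgState A b i).r ≠ 0 := fun i h =>
    hne (cgState_r_eq_zero_of_le A b (Nat.lt_succ_iff.1 i.2) h)
  have key : ∀ i j : ℕ, i < j → inner ℝ (cgState A b j).r (cgState A b i).r = 0 := fun i j hij =>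
    inner_cgState_r_eq_zero hA hpos b (cgSpan_mono A b hij (cgState_r_mem_cgSpan A b i))
  -- Otherwise there would be dim E + 1 nonzero, pairwise orthogonal residuals.
  have hli : LinearIndependent ℝ
      (fun i : Fin (Module.finrank ℝ E + 1) => (cgState A b i).r) := by
    refine linearIndependent_of_ne_zero_of_inner_eq_zero hne' fun i j hij => ?_
    rcases lt_or_gt_of_ne (Fin.val_ne_of_ne hij) with h | h
    · rw [real_inner_comm]; exact key _ _ h
    · exact key _ _ h
  have := hli.fintype_card_le_finrank
  simp at this

include hA hpos in
/-- The conjugate gradient iterate minimizes the energy of the error over the Krylov space. -/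
theorem energy_cgIterate_le {e v : E} {q : ℕ} (he : A e = b) (hv : v ∈ cgSpan A b q) :
    inner ℝ (e - cgIterate A b q) (A (e - cgIterate A b q)) ≤ inner ℝ (e - v) (A (e - v)) := by
  have hr : A (e - cgIterate A b q) = (cgState A b q).r := by
    rw [cgState_r_eq, map_sub, he]; rfl
  set z := e - cgIterate A b q with hz
  set y := cgIterate A b q - v with hy
  have hzy : e - v = z + y := by rw [hz, hy]; abel
  -- The cross term vanishes, so the claim is Pythagoras in the energy inner product.
  have horth : inner ℝ (A z) y = 0 := by
    rw [hr]
    exact inner_cgState_r_eq_zero hA hpos b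
      (Submodule.sub_mem _ (cgIterate_mem_cgSpan A b q) hv)
  have hsymm : inner ℝ (A z) y = inner ℝ z (A y) := hA _ _
  have hyy : 0 ≤ inner ℝ y (A y) := by
    by_cases h : y = 0
    · simp [h]
    · exact (hpos y h).le
  rw [hzy, map_add, inner_add_left, inner_add_right, inner_add_right, ← hsymm, horth,
    real_inner_comm (A z) y, horth]
  linarith

-- With P = 1 + X·Q and Ae = b, P(A)e = e + Q(A)b is the error of the competitor -Q(A)b, which lies
-- in the span because deg Q < q.
include hA hpos in
theorem energy_cgIterate_le_aeval {e : E} {q : ℕ} (he : A e = b) {P : Polynomial ℝ}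
    (hP : P.eval 0 = 1) (hdeg : P.natDegree ≤ q) :
    inner ℝ (e - cgIterate A b q) (A (e - cgIterate A b q)) ≤
      inner ℝ (Polynomial.aeval (A : E →ₗ[ℝ] E) P e)
        (A (Polynomial.aeval (A : E →ₗ[ℝ] E) P e)) := by
  have hv : -(Polynomial.aeval (A : E →ₗ[ℝ] E) P.divX b) ∈ cgSpan A b q := by
    refine Submodule.neg_mem _ ?_
    -- Truncated subtraction gives deg Q = 0, not less than q, when q = 0; but then Q = 0.
    by_cases h0 : P.natDegree = 0
    · rw [Polynomial.divX_eq_zero_iff.2 (Polynomial.eq_C_of_natDegree_eq_zero h0)]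
      simp
    · exact aeval_apply_mem_cgSpan hA hpos b
        (by rw [Polynomial.natDegree_divX_eq_natDegree_tsub_one]; omega)
  have hPe : Polynomial.aeval (A : E →ₗ[ℝ] E) P e =
      e - -(Polynomial.aeval (A : E →ₗ[ℝ] E) P.divX b) := by
    conv_lhs => rw [← Polynomial.divX_mul_X_add P]
    rw [Polynomial.coeff_zero_eq_eval_zero, hP, map_add, map_mul, Polynomial.aeval_X, ← he]
    simp [add_comm]
  rw [hPe]
  exact energy_cgIterate_le hA hpos b he hv

end ConjugateGradientTheory

/-! ### Chebyshev polynomials on an interval -/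

/-- Conjugate gradient polynomials: for `κ > 1` there is a polynomial of degree at most `q` that
takes the value `1` at `0` and is at most `2 exp (-2 q / √κ)` on `[a, κ a]`. -/
theorem exists_polynomial_abs_le {a κ : ℝ} (ha : 0 < a) (hκ : 1 < κ) (q : ℕ) :
    ∃ P : Polynomial ℝ, P.eval 0 = 1 ∧ P.natDegree ≤ q ∧
      ∀ x ∈ Set.Icc a (κ * a), |P.eval x| ≤ 2 * Real.exp (-(2 * q / √κ)) := by
  have hs1 : 1 < √κ := Real.lt_sqrt_of_sq_lt (by simpa using hκ)
  have hs0 : 0 < √κ := by positivity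
  have hsq : √κ ^ 2 = κ := Real.sq_sqrt (by linarith)
  set s := √κ with hs
  -- Chosen so that cosh t = (κ+1)/(κ-1), the image of 0 under the affine map sending a to 1 and κa
  -- to -1.
  set t := Real.log ((s + 1) / (s - 1)) with ht
  have hs1' : 0 < s - 1 := by linarith
  have hκ1 : 0 < κ - 1 := by linarith
  have ht2 : 2 / s ≤ t := by
    have hx : |1 / s| < 1 := by
      rw [abs_of_pos (by positivity), div_lt_one hs0]; exact hs1
    -- First term of the series of log(1+x) - log(1-x) at x = 1/√κ; all terms are nonnegative.
    have h := le_hasSum (Real.hasSum_log_sub_log_of_abs_lt_one hx) 0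
      (fun j _ => by positivity)
    have h2 : Real.log (1 + 1 / s) - Real.log (1 - 1 / s) = t := by
      rw [abs_of_pos (by positivity)] at hx
      rw [← Real.log_div (by positivity) (by linarith), ht]
      congr 1
      field_simp
    rw [h2] at h
    simpa [div_eq_mul_inv] using h
  have ht0 : 0 ≤ t := le_trans (by positivity) ht2
  have hcosh : Real.cosh t = (κ + 1) / (κ - 1) := by
    rw [Real.cosh_eq, Real.exp_neg, ht, Real.exp_log (by positivity), ← hsq]
    have : s ^ 2 - 1 ≠ 0 := by rw [hsq]; exact hκ1.ne'
    field_simp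
    ring
  have hT : Real.exp (2 * q / s) / 2 ≤ (Polynomial.Chebyshev.T ℝ q).eval ((κ + 1) / (κ - 1)) := by
    rw [← hcosh, Polynomial.Chebyshev.T_real_cosh, Real.cosh_eq]
    have h1 : Real.exp (2 * q / s) ≤ Real.exp (((q : ℤ) : ℝ) * t) := by
      apply Real.exp_le_exp.2
      push_cast
      calc 2 * q / s = q * (2 / s) := by ring
        _ ≤ q * t := by gcongr
    have h2 := Real.exp_pos (-(((q : ℤ) : ℝ) * t))
    linarith
  set τ := (Polynomial.Chebyshev.T ℝ q).eval ((κ + 1) / (κ - 1)) with hτ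
  have hτ0 : 0 < τ := lt_of_lt_of_le (by positivity) hT
  -- The Chebyshev polynomial transported to [a, κa] and normalized at 0. There |T_q| ≤ 1, while τ ≥
  -- e^{qt}/2 from T_q(cosh t) = cosh(qt).
  refine ⟨Polynomial.C τ⁻¹ * (Polynomial.Chebyshev.T ℝ q).comp
    (Polynomial.C ((κ + 1) / (κ - 1)) - Polynomial.C (2 / (a * (κ - 1))) * Polynomial.X),
    ?_, ?_, ?_⟩
  · simp [Polynomial.eval_comp, ← hτ, hτ0.ne']
  · refine (Polynomial.natDegree_C_mul_le _ _).trans (Polynomial.natDegree_comp_le.trans ?_)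
    rw [Polynomial.Chebyshev.natDegree_T]
    refine (Nat.mul_le_mul_left _ (?_ : _ ≤ 1)).trans (by simp)
    compute_degree
  · rintro x ⟨hx1, hx2⟩
    have hab : |(κ + 1) / (κ - 1) - 2 / (a * (κ - 1)) * x| ≤ 1 := by
      have : (κ + 1) / (κ - 1) - 2 / (a * (κ - 1)) * x =
          (a * (κ + 1) - 2 * x) / (a * (κ - 1)) := by field_simp
      rw [this, abs_div, abs_of_pos (mul_pos ha hκ1), div_le_one (mul_pos ha hκ1), abs_le]
      constructor <;> nlinarith
    have h1 := Polynomial.Chebyshev.abs_eval_T_real_le_one (q : ℤ) hab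
    simp only [Polynomial.eval_mul, Polynomial.eval_C, Polynomial.eval_comp, Polynomial.eval_sub,
      Polynomial.eval_X]
    rw [abs_mul, abs_of_pos (inv_pos.2 hτ0)]
    calc τ⁻¹ * _ ≤ τ⁻¹ * 1 := by gcongr
      _ ≤ (Real.exp (2 * q / s) / 2)⁻¹ := by
        rw [mul_one]; exact inv_anti₀ (by positivity) hT
      _ = _ := by rw [Real.exp_neg, inv_div]; rfl

/-! ### Energy bounds by diagonalization -/

section SpectralBound

variable {E : Type*} [NormedAddCommGroup E] [InnerProductSpace ℝ E] [FiniteDimensional ℝ E]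

theorem LinearMap.IsSymmetric.repr_aeval_apply {A : E →ₗ[ℝ] E} (hA : A.IsSymmetric)
    (P : Polynomial ℝ) (v : E) (i : Fin (Module.finrank ℝ E)) :
    (hA.eigenvectorBasis rfl).repr (Polynomial.aeval A P v) i =
      P.eval (hA.eigenvalues rfl i) * (hA.eigenvectorBasis rfl).repr v i := by
  induction P using Polynomial.induction_on' with
  | add p q hp hq => simp [hp, hq, add_mul]
  | monomial k a =>
    have hpow : ∀ k : ℕ, (hA.eigenvectorBasis rfl).repr ((A ^ k) v) i =
        hA.eigenvalues rfl i ^ k * (hA.eigenvectorBasis rfl).repr v i := by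
      intro k
      induction k with
      | zero => simp
      | succ k ih =>
        rw [pow_succ', Module.End.mul_apply, hA.eigenvectorBasis_apply_self_apply, ih, pow_succ']
        simp [mul_assoc]
    rw [Polynomial.aeval_monomial]
    simp [hpow, mul_assoc]

theorem LinearMap.IsSymmetric.inner_apply_self_eq_sum {A : E →ₗ[ℝ] E} (hA : A.IsSymmetric)
    (v : E) : inner ℝ v (A v) =
      ∑ i, hA.eigenvalues rfl i * (hA.eigenvectorBasis rfl).repr v i ^ 2 := by
  rw [← (hA.eigenvectorBasis rfl).repr.inner_map_map, PiLp.inner_apply]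
  refine Finset.sum_congr rfl fun i _ => ?_
  rw [hA.eigenvectorBasis_apply_self_apply]
  simp
  ring

theorem LinearMap.IsSymmetric.eigenvalues_mem_Icc {A : E →ₗ[ℝ] E} (hA : A.IsSymmetric) {a c : ℝ}
    (hlow : ∀ v, a * ‖v‖ ^ 2 ≤ inner ℝ v (A v)) (hup : ∀ v, inner ℝ v (A v) ≤ c * ‖v‖ ^ 2)
    (i : Fin (Module.finrank ℝ E)) : hA.eigenvalues rfl i ∈ Set.Icc a c := by
  have h1 := hlow (hA.eigenvectorBasis rfl i)
  have h2 := hup (hA.eigenvectorBasis rfl i)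
  rw [hA.apply_eigenvectorBasis, inner_smul_right, real_inner_self_eq_norm_sq,
    (hA.eigenvectorBasis rfl).orthonormal.1 i] at h1 h2
  simpa using And.intro h1 h2

/-- A polynomial bounded on an interval containing the spectrum contracts the energy. -/
theorem LinearMap.IsSymmetric.energy_aeval_le {A : E →ₗ[ℝ] E} (hA : A.IsSymmetric) {a c M : ℝ}
    (ha : 0 ≤ a) (hlow : ∀ v, a * ‖v‖ ^ 2 ≤ inner ℝ v (A v))
    (hup : ∀ v, inner ℝ v (A v) ≤ c * ‖v‖ ^ 2) {P : Polynomial ℝ}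
    (hP : ∀ x ∈ Set.Icc a c, |P.eval x| ≤ M) (v : E) :
    inner ℝ (Polynomial.aeval A P v) (A (Polynomial.aeval A P v)) ≤
      M ^ 2 * inner ℝ v (A v) := by
  rw [hA.inner_apply_self_eq_sum, hA.inner_apply_self_eq_sum, Finset.mul_sum]
  refine Finset.sum_le_sum fun i _ => ?_
  have hi := hA.eigenvalues_mem_Icc hlow hup i
  have h0 : 0 ≤ hA.eigenvalues rfl i := ha.trans hi.1
  rw [hA.repr_aeval_apply, mul_pow, mul_left_comm]
  have : P.eval (hA.eigenvalues rfl i) ^ 2 ≤ M ^ 2 := sq_le_sq'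
    (by linarith [neg_abs_le (P.eval (hA.eigenvalues rfl i)), hP _ hi])
    ((le_abs_self _).trans (hP _ hi))
  gcongr

/-- `‖A v‖² ≤ c ⟨v, A v⟩` for a symmetric `A` with spectrum in `[0, c]`. -/
theorem LinearMap.IsSymmetric.norm_apply_sq_le {A : E →ₗ[ℝ] E} (hA : A.IsSymmetric) {c : ℝ}
    (hlow : ∀ v, 0 ≤ inner ℝ v (A v)) (hup : ∀ v, inner ℝ v (A v) ≤ c * ‖v‖ ^ 2) (v : E) :
    ‖A v‖ ^ 2 ≤ c * inner ℝ v (A v) := by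
  rw [hA.inner_apply_self_eq_sum, ← (hA.eigenvectorBasis rfl).repr.norm_map,
    EuclideanSpace.norm_sq_eq, Finset.mul_sum]
  refine Finset.sum_le_sum fun i _ => ?_
  have hi := hA.eigenvalues_mem_Icc (a := 0) (by simpa using hlow) hup i
  rw [hA.eigenvectorBasis_apply_self_apply, Real.norm_eq_abs, sq_abs, mul_pow, ← mul_assoc]
  simp only [RCLike.ofReal_real_eq_id, id_eq]
  rw [sq (hA.eigenvalues rfl i)]
  have := hi.1; have := hi.2
  gcongr

end SpectralBound

/-! ### Conjugate gradient on the regularized system -/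

section RegularizedSystem

variable {E : Type*} [NormedAddCommGroup E] [InnerProductSpace ℝ E]
  {H : E →L[ℝ] E} {γ θ κ : ℝ} {g : E}

theorem regularized_isSymmetric (hH : H.IsPositive) (γ : ℝ) :
    ((H + γ • ContinuousLinearMap.id ℝ E : E →L[ℝ] E) : E →ₗ[ℝ] E).IsSymmetric := by
  intro v w
  have := hH.isSymmetric v w
  simp only [ContinuousLinearMap.coe_coe] at this
  simp [inner_add_left, inner_add_right, inner_smul_left, inner_smul_right, this]

theorem regularized_energy_eq (H : E →L[ℝ] E) (γ : ℝ) (v : E) :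
    inner ℝ v ((H + γ • ContinuousLinearMap.id ℝ E) v) = inner ℝ v (H v) + γ * ‖v‖ ^ 2 := by
  simp [inner_add_right, inner_smul_right]

theorem le_regularized_energy (hH : H.IsPositive) (γ : ℝ) (v : E) :
    γ * ‖v‖ ^ 2 ≤ inner ℝ v ((H + γ • ContinuousLinearMap.id ℝ E) v) := by
  rw [regularized_energy_eq]
  linarith [hH.inner_nonneg_right v]

theorem regularized_energy_le (H : E →L[ℝ] E) (γ : ℝ) (v : E) :
    inner ℝ v ((H + γ • ContinuousLinearMap.id ℝ E) v) ≤ (‖H‖ + γ) * ‖v‖ ^ 2 := by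
  rw [regularized_energy_eq]
  have h1 := real_inner_le_norm v (H v)
  have h2 := mul_le_mul_of_nonneg_left (H.le_opNorm v) (norm_nonneg v)
  nlinarith

theorem regularized_energy_pos (hH : H.IsPositive) (hγ : 0 < γ) (v : E) (hv : v ≠ 0) :
    0 < inner ℝ v ((H + γ • ContinuousLinearMap.id ℝ E) v) :=
  lt_of_lt_of_le (by positivity) (le_regularized_energy hH γ v)

theorem regularized_cgIterate_add (H : E →L[ℝ] E) (γ : ℝ) (g : E) (q : ℕ) :
    (H + γ • ContinuousLinearMap.id ℝ E)
        (cgIterate (H + γ • ContinuousLinearMap.id ℝ E) (-g) q) + g =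
      -(cgState (H + γ • ContinuousLinearMap.id ℝ E) (-g) q).r := by
  rw [cgState_r_eq, cgIterate]
  abel

/-- The residual of the step is orthogonal to the step. -/
theorem inner_cgInexactStep_residual (hH : H.IsPositive) (hγ : 0 < γ) (θ : ℝ) (g : E) :
    inner ℝ ((H + γ • ContinuousLinearMap.id ℝ E) (cgInexactStep θ γ H g) + g)
      (cgInexactStep θ γ H g) = 0 := by
  rw [cgInexactStep, regularized_cgIterate_add, inner_neg_left,
    inner_cgState_r_eq_zero (regularized_isSymmetric hH γ) (regularized_energy_pos hH hγ) _
      (cgIterate_mem_cgSpan _ _ _), neg_zero]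

theorem energy_cgInexactStep (hH : H.IsPositive) (hγ : 0 < γ) (θ : ℝ) (g : E) :
    inner ℝ (cgInexactStep θ γ H g)
        ((H + γ • ContinuousLinearMap.id ℝ E) (cgInexactStep θ γ H g)) =
      -inner ℝ g (cgInexactStep θ γ H g) := by
  have h := inner_cgInexactStep_residual hH hγ θ g
  rw [inner_add_left, real_inner_comm] at h
  linarith

/-- With w = Av this reads ⟨w, A⁻¹w⟩ ≤ ‖w‖²/γ without mentioning the inverse; it follows from γ‖v‖²
≤ ⟨v, w⟩ ≤ ‖v‖‖w‖. -/
theorem regularized_energy_le_div (hH : H.IsPositive) (hγ : 0 < γ) (v : E) :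
    inner ℝ v ((H + γ • ContinuousLinearMap.id ℝ E) v) ≤
      ‖(H + γ • ContinuousLinearMap.id ℝ E) v‖ ^ 2 / γ := by
  have h1 := le_regularized_energy hH γ v
  have h2 := real_inner_le_norm v ((H + γ • ContinuousLinearMap.id ℝ E) v)
  set w := (H + γ • ContinuousLinearMap.id ℝ E) v
  rw [le_div_iff₀ hγ]
  nlinarith [sq_nonneg (γ * ‖v‖ - ‖w‖), norm_nonneg v, norm_nonneg w]

variable [FiniteDimensional ℝ E]

theorem regularized_surjective (hH : H.IsPositive) (hγ : 0 < γ) :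
    Function.Surjective (H + γ • ContinuousLinearMap.id ℝ E) := by
  have hinj : Function.Injective
      ((H + γ • ContinuousLinearMap.id ℝ E : E →L[ℝ] E) : E →ₗ[ℝ] E) := by
    rw [← LinearMap.ker_eq_bot, LinearMap.ker_eq_bot']
    intro v hv
    by_contra hne
    have := regularized_energy_pos hH hγ v hne
    rw [ContinuousLinearMap.coe_coe] at hv
    rw [hv, inner_zero_right] at this
    exact this.false
  exact LinearMap.surjective_of_injective hinj

/-- Chebyshev bound for the residuals of conjugate gradient. -/
theorem norm_cgState_r_le (hH : H.IsPositive) (hγ : 0 < γ) (hκ : 1 < κ)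
    (hHκ : ‖H‖ + γ ≤ κ * γ) (b : E) (q : ℕ) :
    ‖(cgState (H + γ • ContinuousLinearMap.id ℝ E) b q).r‖ ≤
      2 * √((‖H‖ + γ) / γ) * Real.exp (-(2 * q / √κ)) * ‖b‖ := by
  obtain ⟨P, hP0, hPdeg, hP⟩ := exists_polynomial_abs_le hγ hκ q
  obtain ⟨e, he⟩ := regularized_surjective hH hγ b
  have hsymm := regularized_isSymmetric hH γ
  have hlow := le_regularized_energy hH γ
  have hup := regularized_energy_le H γ
  have hdiv := regularized_energy_le_div hH hγ e
  have hr : (cgState (H + γ • ContinuousLinearMap.id ℝ E) b q).r =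
      (H + γ • ContinuousLinearMap.id ℝ E)
        (e - cgIterate (H + γ • ContinuousLinearMap.id ℝ E) b q) := by
    rw [cgState_r_eq, map_sub, he]; rfl
  -- The squared residual is at most ‖H‖ + γ times the energy of the error. That energy is
  -- contracted by P from the initial one, which is at most ‖b‖²/γ.
  have hmin := energy_cgIterate_le_aeval hsymm (regularized_energy_pos hH hγ) b he hP0 hPdeg
  rw [he] at hdiv
  set A := H + γ • ContinuousLinearMap.id ℝ E
  have hc : 0 < ‖H‖ + γ := by positivity
  have h1 := hsymm.energy_aeval_le hγ.le hlow
    (fun v => (hup v).trans (mul_le_mul_of_nonneg_right hHκ (by positivity))) hP e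
  have h2 := hsymm.norm_apply_sq_le
    (fun v => le_trans (by positivity) (hlow v)) hup (e - cgIterate A b q)
  simp only [ContinuousLinearMap.coe_coe] at h1 h2
  rw [he] at h1
  refine le_of_sq_le_sq ?_ (by positivity)
  rw [hr]
  calc ‖A (e - cgIterate A b q)‖ ^ 2
      ≤ (‖H‖ + γ) * ((2 * Real.exp (-(2 * q / √κ))) ^ 2 * (‖b‖ ^ 2 / γ)) := by
        refine h2.trans ?_
        gcongr
        refine hmin.trans (h1.trans ?_)
        gcongr
    _ = _ := by
        rw [mul_pow, mul_pow, mul_pow, mul_pow, Real.sq_sqrt (by positivity)]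
        ring

/-- With ρ = (‖H‖+γ)/γ, condition (1) follows from 2√ρ e^{-2q/√κ} ≤ θ/√ρ. As ρ ≤ κ, it suffices that
the exponential is at most θ/(2κ), whence the logarithm in the bound. -/
theorem isInexactStep_cgIterate_of_le (hH : H.IsPositive) (hγ : 0 < γ) (hκ : 1 < κ)
    (hHκ : ‖H‖ + γ ≤ κ * γ) (hθ : 0 < θ) (g : E) {q : ℕ}
    (hq : 1 / 2 * √κ * Real.log (2 * κ / θ) ≤ q) :
    IsInexactStep θ γ H g (cgIterate (H + γ • ContinuousLinearMap.id ℝ E) (-g) q) := by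
  have hs : 0 < √κ := Real.sqrt_pos.2 (by linarith)
  have hc : 0 < ‖H‖ + γ := by positivity
  rw [IsInexactStep, regularized_cgIterate_add, norm_neg]
  refine (norm_cgState_r_le hH hγ hκ hHκ (-g) q).trans ?_
  rw [norm_neg]
  refine mul_le_mul_of_nonneg_right ?_ (norm_nonneg g)
  have hexp : Real.exp (-(2 * q / √κ)) ≤ θ / (2 * κ) := by
    rw [Real.exp_neg]
    have h1 : 2 * κ / θ ≤ Real.exp (2 * q / √κ) := by
      rw [← Real.log_le_iff_le_exp (by positivity), le_div_iff₀ hs]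
      linarith
    calc _ ≤ (2 * κ / θ)⁻¹ := inv_anti₀ (by positivity) h1
      _ = _ := inv_div _ _
  set ρ := (‖H‖ + γ) / γ with hρ
  have hρ0 : 0 < ρ := by positivity
  have hρκ : ρ ≤ κ := by rwa [hρ, div_le_iff₀ hγ]
  have hinv : √(γ / (‖H‖ + γ)) = (√ρ)⁻¹ := by rw [← Real.sqrt_inv, hρ, inv_div]
  rw [hinv]
  have hsρ : 0 < √ρ := Real.sqrt_pos.2 hρ0
  calc 2 * √ρ * Real.exp (-(2 * q / √κ)) ≤ 2 * √ρ * (θ / (2 * κ)) := by gcongr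
    _ ≤ 2 * √ρ * (θ / (2 * ρ)) := by gcongr
    _ = θ * (√ρ)⁻¹ := by
      have : ρ = √ρ * √ρ := (Real.mul_self_sqrt hρ0.le).symm
      rw [← div_eq_mul_inv, mul_div_assoc', div_eq_div_iff (by positivity) hsρ.ne']
      linear_combination (-2 * θ) * this

theorem isInexactStep_cgIterate_finrank (hH : H.IsPositive) (hγ : 0 < γ) (hθ : 0 ≤ θ) (g : E) :
    IsInexactStep θ γ H g
      (cgIterate (H + γ • ContinuousLinearMap.id ℝ E) (-g) (Module.finrank ℝ E)) := by
  rw [IsInexactStep, regularized_cgIterate_add, cgState_r_finrank_eq_zero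
    (regularized_isSymmetric hH γ) (regularized_energy_pos hH hγ)]
  simp only [neg_zero, norm_zero]
  positivity

/-- Finite termination makes the set in `cgCount` nonempty, so its `sInf` is attained rather than
the default 0. -/
theorem isInexactStep_cgInexactStep (hH : H.IsPositive) (hγ : 0 < γ) (hθ : 0 ≤ θ) (g : E) :
    IsInexactStep θ γ H g (cgInexactStep θ γ H g) :=
  Nat.sInf_mem (s := {q : ℕ | IsInexactStep θ γ H g
    (cgIterate (H + γ • ContinuousLinearMap.id ℝ E) (-g) q)})
    ⟨_, isInexactStep_cgIterate_finrank hH hγ hθ g⟩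

theorem cgCount_le_cgBound (hH : H.IsPositive) (hγ : 0 < γ) (hκ : 1 < κ)
    (hHκ : ‖H‖ + γ ≤ κ * γ) (hθ : 0 ≤ θ) (g : E) :
    cgCount θ γ H g ≤ cgBound (Module.finrank ℝ E) κ θ := by
  have h1 : cgCount θ γ H g ≤ Module.finrank ℝ E :=
    Nat.sInf_le (isInexactStep_cgIterate_finrank hH hγ hθ g)
  rw [cgBound]
  split_ifs with h
  · exact h1
  · exact le_min h1 (Nat.sInf_le (isInexactStep_cgIterate_of_le hH hγ hκ hHκ
      (lt_of_le_of_ne hθ (Ne.symm h)) g (Nat.le_ceil _)))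

/-- Energy of the step, in terms of the right-hand side and the residual. -/
theorem le_energy_cgInexactStep (hH : H.IsPositive) (hγ : 0 < γ) (hθ : 0 ≤ θ) (g : E) :
    (1 - θ ^ 2) * ‖g‖ ^ 2 / (‖H‖ + γ) ≤ inner ℝ (cgInexactStep θ γ H g)
      ((H + γ • ContinuousLinearMap.id ℝ E) (cgInexactStep θ γ H g)) := by
  have hc : 0 < ‖H‖ + γ := by positivity
  have hsymm := regularized_isSymmetric hH γ
  have hlow := le_regularized_energy hH γ
  have hup := regularized_energy_le H γ
  have horth := inner_cgInexactStep_residual hH hγ θ g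
  have hin := isInexactStep_cgInexactStep hH hγ hθ g
  have hsurj := regularized_surjective hH hγ
  have hdivt := regularized_energy_le_div hH hγ
  rw [IsInexactStep] at hin
  set A := H + γ • ContinuousLinearMap.id ℝ E
  set s := cgInexactStep θ γ H g
  -- Here e = A⁻¹g and f = A⁻¹t for the residual t = As + g. Since t is orthogonal to s, ⟨f, t⟩ =
  -- ⟨e, g⟩ - ⟨s, As⟩.
  obtain ⟨e, he⟩ := hsurj g
  obtain ⟨f, hf⟩ := hsurj (A s + g)
  have hs : f = s + e := by
    by_contra hne
    have h0 : f - (s + e) ≠ 0 := sub_ne_zero.2 hne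
    have := regularized_energy_pos hH hγ _ h0
    have hz : A (f - (s + e)) = 0 := by rw [map_sub, map_add, hf, he]; abel
    change 0 < inner ℝ _ (A _) at this
    rw [hz, inner_zero_right] at this
    exact this.false
  have h2 := hsymm.norm_apply_sq_le (fun v => le_trans (by positivity) (hlow v)) hup e
  simp only [ContinuousLinearMap.coe_coe] at h2
  rw [he] at h2
  have h3 := hdivt f
  rw [hf] at h3
  have hsq : ‖A s + g‖ ^ 2 ≤ θ ^ 2 * (γ / (‖H‖ + γ)) * ‖g‖ ^ 2 := by
    calc _ ≤ (θ * √(γ / (‖H‖ + γ)) * ‖g‖) ^ 2 := by gcongr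
      _ = _ := by rw [mul_pow, mul_pow, Real.sq_sqrt (by positivity)]
  -- The weight γ/(‖H‖+γ) of the squared tolerance cancels the factor 1/γ.
  have h4 : inner ℝ f (A s + g) ≤ θ ^ 2 * ‖g‖ ^ 2 / (‖H‖ + γ) := by
    refine h3.trans ?_
    rw [div_le_iff₀ hγ]
    refine hsq.trans (le_of_eq ?_)
    field_simp
  have h5 : ‖g‖ ^ 2 / (‖H‖ + γ) ≤ inner ℝ e g := by
    rw [div_le_iff₀ hc]; linarith
  have h6 : inner ℝ s (A e) = inner ℝ (A s) e := (hsymm s e).symm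
  rw [he] at h6
  have h7 : inner ℝ f (A s + g) = inner ℝ e g + inner ℝ e (A s) := by
    rw [hs, inner_add_left, real_inner_comm, horth, zero_add, inner_add_right, add_comm]
  have h8 : inner ℝ s (A s) = - inner ℝ e (A s) := by
    have := horth
    rw [inner_add_left, real_inner_comm s (A s), real_inner_comm s g, h6,
      real_inner_comm e (A s)] at this
    linarith
  rw [h8]
  have : (1 - θ ^ 2) * ‖g‖ ^ 2 / (‖H‖ + γ) =
      ‖g‖ ^ 2 / (‖H‖ + γ) - θ ^ 2 * ‖g‖ ^ 2 / (‖H‖ + γ) := by ring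
  linarith

theorem cgInexactStep_ne_zero (hH : H.IsPositive) (hγ : 0 < γ) (hθ : 0 ≤ θ) (hθ1 : θ < 1)
    (hg : g ≠ 0) : cgInexactStep θ γ H g ≠ 0 := by
  intro h
  have h1 := le_energy_cgInexactStep hH hγ hθ g
  rw [h, inner_zero_left] at h1
  have h2 : 0 < 1 - θ ^ 2 := by nlinarith
  have h3 : 0 < ‖g‖ := norm_pos_iff.2 hg
  have h4 : 0 < (1 - θ ^ 2) * ‖g‖ ^ 2 / (‖H‖ + γ) := by positivity
  linarith

end RegularizedSystem

/-! ### Descent lemma -/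

section Descent

variable {E : Type*} [NormedAddCommGroup E] [InnerProductSpace ℝ E] [CompleteSpace E]

/-- Descent lemma: a function with `L`-Lipschitz gradient lies below its quadratic upper model. -/
theorem le_add_inner_add_sq_of_lipschitz_gradient {f : E → ℝ} {f' : E → E} {L : ℝ}
    (hf : ∀ v, HasGradientAt f (f' v) v) (hL : ∀ v w, ‖f' v - f' w‖ ≤ L * ‖v - w‖) (u s : E) :
    f (u + s) ≤ f u + inner ℝ (f' u) s + L / 2 * ‖s‖ ^ 2 := by
  -- Along the segment, the gap between f and its upper model has nonpositive derivative; the claim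
  -- compares the endpoints t = 0 and t = 1.
  have hφ : ∀ t : ℝ, HasDerivAt
      (fun t : ℝ => f (u + t • s) - t * inner ℝ (f' u) s - L / 2 * ‖s‖ ^ 2 * t ^ 2)
      (inner ℝ (f' (u + t • s)) s - inner ℝ (f' u) s - L / 2 * ‖s‖ ^ 2 * (2 * t)) t := by
    intro t
    have h1 : HasDerivAt (fun t : ℝ => u + t • s) s t := by
      simpa using ((hasDerivAt_id t).smul_const s).const_add u
    have h2 := (hf (u + t • s)).hasFDerivAt.comp_hasDerivAt t h1
    have h3 := (hasDerivAt_id t).mul_const (inner ℝ (f' u) s)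
    have h4 := (hasDerivAt_pow 2 t).const_mul (L / 2 * ‖s‖ ^ 2)
    refine ((h2.sub h3).sub h4).congr_deriv ?_
    simp
  have hanti : AntitoneOn
      (fun t : ℝ => f (u + t • s) - t * inner ℝ (f' u) s - L / 2 * ‖s‖ ^ 2 * t ^ 2)
      (Set.Icc 0 1) := by
    refine antitoneOn_of_deriv_nonpos (convex_Icc 0 1)
      (fun t _ => (hφ t).continuousAt.continuousWithinAt)
      (fun t _ => (hφ t).differentiableAt.differentiableWithinAt) fun t ht => ?_
    rw [interior_Icc] at ht
    rw [(hφ t).deriv, ← inner_sub_left]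
    have h1 := real_inner_le_norm (f' (u + t • s) - f' u) s
    have h2 := hL (u + t • s) u
    rw [add_sub_cancel_left, norm_smul, Real.norm_of_nonneg ht.1.le] at h2
    have h3 := mul_le_mul_of_nonneg_right h2 (norm_nonneg s)
    nlinarith
  have := hanti (Set.left_mem_Icc.2 zero_le_one) (Set.right_mem_Icc.2 zero_le_one) zero_le_one
  simp at this
  linarith

end Descent

/-! ### Gradient of the reduced objective; one step of the method -/

namespace ImplicitLS

variable {ny n m p : ℕ} {P : ImplicitLS ny n m p}

/-- Derivative of the solution map, by the implicit function theorem. -/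
theorem WellPosed.hasFDerivAt_y (hP : P.WellPosed) (u : Euc n) :
    HasFDerivAt P.y (-((P.cy u).inverse.comp (P.cu u))) u := by
  -- The arguments are swapped because the implicit function is obtained in the second factor.
  set f : Euc n × Euc ny → Euc p := fun z => P.c (z.2, z.1) with hf
  set f' := fderiv ℝ f (u, P.y u) with hf'
  have hfc : ContDiff ℝ 1 f := hP.contDiff_c.comp (contDiff_snd.prodMk contDiff_fst)
  have hfs : HasStrictFDerivAt f f' (u, P.y u) :=
    hfc.contDiffAt.hasStrictFDerivAt one_ne_zero
  have hcy : f' ∘L .inr ℝ (Euc n) (Euc ny) = P.cy u := by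
    have h1 : HasFDerivAt (fun v : Euc ny => ((u, v) : Euc n × Euc ny))
        (.inr ℝ (Euc n) (Euc ny)) (P.y u) := hasFDerivAt_prodMk_right u (P.y u)
    exact (HasFDerivAt.comp (P.y u) hfs.hasFDerivAt h1).fderiv.symm
  have hcu : f' ∘L .inl ℝ (Euc n) (Euc ny) = P.cu u := by
    have h1 : HasFDerivAt (fun w : Euc n => ((w, P.y u) : Euc n × Euc ny))
        (.inl ℝ (Euc n) (Euc ny)) u := hasFDerivAt_prodMk_left u (P.y u)
    exact (HasFDerivAt.comp u hfs.hasFDerivAt h1).fderiv.symm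
  have hinv : (f' ∘L .inr ℝ (Euc n) (Euc ny)).IsInvertible := by
    rw [hcy]; exact hP.invertible_cy u
  have h0 : f (u, P.y u) = 0 := (hP.solution u _).2 rfl
  have hev := hfs.eventually_apply_implicitFunctionOfProdDomain hinv
  have hder := (hfs.hasStrictFDerivAt_implicitFunctionOfProdDomain hinv).hasFDerivAt
  rw [hcy, hcu] at hder
  have : -((P.cy u).inverse.comp (P.cu u)) = -(P.cy u).inverse ∘L P.cu u := by
    ext v; simp
  rw [this]
  -- Uniqueness of the solution identifies y with the local implicit function, so no prior
  -- continuity of y is needed.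
  refine hder.congr_of_eventuallyEq ?_
  filter_upwards [hev] with w hw
  rw [h0] at hw
  exact ((hP.solution w _).1 hw).symm

theorem WellPosed.hasFDerivAt_Rhat (hP : P.WellPosed) (u : Euc n) :
    HasFDerivAt P.Rhat (P.Ghat u) u := by
  set R' := fderiv ℝ P.R (P.y u, u) with hR'
  have hR : HasFDerivAt P.R R' (P.y u, u) := (hP.differentiable_R u).hasFDerivAt
  have hGy : R' ∘L .inl ℝ (Euc ny) (Euc n) = P.Gy u := by
    have h1 : HasFDerivAt (fun v : Euc ny => ((v, u) : Euc ny × Euc n))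
        (.inl ℝ (Euc ny) (Euc n)) (P.y u) := hasFDerivAt_prodMk_left (P.y u) u
    exact (HasFDerivAt.comp (P.y u) hR h1).fderiv.symm
  have hGu : R' ∘L .inr ℝ (Euc ny) (Euc n) = P.Gu u := by
    have h1 : HasFDerivAt (fun w : Euc n => ((P.y u, w) : Euc ny × Euc n))
        (.inr ℝ (Euc ny) (Euc n)) u := hasFDerivAt_prodMk_right (P.y u) u
    exact (HasFDerivAt.comp u hR h1).fderiv.symm
  have h := HasFDerivAt.comp u (f := fun w => (P.y w, w)) hR
    ((hP.hasFDerivAt_y u).prodMk (hasFDerivAt_id u))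
  refine h.congr_fderiv ?_
  ext1 v
  simp only [Ghat, ← hGy, ← hGu, ContinuousLinearMap.comp_apply, sub_apply,
    ContinuousLinearMap.inl_apply, ContinuousLinearMap.inr_apply, ContinuousLinearMap.prod_apply,
    neg_apply, ContinuousLinearMap.id_apply]
  rw [← map_sub]
  simp

/-- The adjoint formula computes the gradient of the reduced objective. -/
theorem WellPosed.hasGradientAt_Jhat (hP : P.WellPosed) (u : Euc n) :
    HasGradientAt P.Jhat (P.grad u) u := by
  have h := ((hP.hasFDerivAt_Rhat u).norm_sq).const_mul (1 / 2 : ℝ)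
  rw [hasGradientAt_iff_hasFDerivAt]
  refine h.congr_fderiv ?_
  ext1 v
  simp [grad, ContinuousLinearMap.adjoint_inner_left]

theorem Jhat_nonneg (P : ImplicitLS ny n m p) (u : Euc n) : 0 ≤ P.Jhat u := by
  unfold Jhat; positivity

theorem WellPosed.Jhat_add_le (hP : P.WellPosed) {L : ℝ} (hL : P.LipschitzGradient L)
    (u s : Euc n) : P.Jhat (u + s) ≤ P.Jhat u + inner ℝ (P.grad u) s + L / 2 * ‖s‖ ^ 2 := by
  refine le_add_inner_add_sq_of_lipschitz_gradient hP.hasGradientAt_Jhat (fun v w => ?_) u s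
  have := hL.2 v w
  rwa [(hP.hasGradientAt_Jhat v).gradient, (hP.hasGradientAt_Jhat w).gradient] at this

section Step

variable {θ γ η L : ℝ} {H : Euc n →L[ℝ] Euc n} {u : Euc n}

/-- The predicted decrease is half the energy of the step. -/
theorem model_zero_sub_model_step (hH : H.IsPositive) (hγ : 0 < γ) (θ : ℝ) (u : Euc n) :
    P.model u H γ 0 - P.model u H γ (P.step θ u H γ) =
      1 / 2 * inner ℝ (P.step θ u H γ)
        ((H + γ • ContinuousLinearMap.id ℝ (Euc n)) (P.step θ u H γ)) := by
  have h := energy_cgInexactStep hH hγ θ (P.grad u)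
  rw [model, model, step]
  simp only [inner_zero_right, inner_zero_left]
  linarith

theorem le_predicted_decrease (hH : H.IsPositive) (hγ : 0 < γ) (hθ : 0 ≤ θ) (u : Euc n) :
    (1 - θ ^ 2) * ‖P.grad u‖ ^ 2 / (2 * (‖H‖ + γ)) ≤
      P.model u H γ 0 - P.model u H γ (P.step θ u H γ) := by
  rw [model_zero_sub_model_step hH hγ]
  have h := le_energy_cgInexactStep hH hγ hθ (P.grad u)
  have hc : 0 < ‖H‖ + γ := by positivity
  have : (1 - θ ^ 2) * ‖P.grad u‖ ^ 2 / (2 * (‖H‖ + γ)) =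
      1 / 2 * ((1 - θ ^ 2) * ‖P.grad u‖ ^ 2 / (‖H‖ + γ)) := by field_simp
  rw [this]
  exact mul_le_mul_of_nonneg_left h (by norm_num)

theorem predicted_decrease_pos (hH : H.IsPositive) (hγ : 0 < γ) (hθ : 0 ≤ θ) (hθ1 : θ < 1)
    (hg : P.grad u ≠ 0) : 0 < P.model u H γ 0 - P.model u H γ (P.step θ u H γ) := by
  have h2 : 0 < 1 - θ ^ 2 := by nlinarith
  have h3 : 0 < ‖P.grad u‖ := norm_pos_iff.2 hg
  exact lt_of_lt_of_le (by positivity) (le_predicted_decrease hH hγ hθ u)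

theorem step_ne_zero (hH : H.IsPositive) (hγ : 0 < γ) (hθ : 0 ≤ θ) (hθ1 : θ < 1)
    (hg : P.grad u ≠ 0) : P.step θ u H γ ≠ 0 :=
  cgInexactStep_ne_zero hH hγ hθ hθ1 hg

/-- A large regularization parameter guarantees a sufficient decrease. -/
theorem WellPosed.le_ratio (hP : P.WellPosed) (hL : P.LipschitzGradient L) (hH : H.IsPositive)
    (hη1 : η < 1) (hγ : 0 < γ) (hLγ : L / (1 - η) ≤ γ) (hθ : 0 ≤ θ) (hθ1 : θ < 1)
    (hg : P.grad u ≠ 0) : η ≤ P.ratio u H γ (P.step θ u H γ) := by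
  have hpos := predicted_decrease_pos hH hγ hθ hθ1 hg
  rw [ratio, le_div_iff₀ hpos]
  have hdesc := hP.Jhat_add_le hL u (P.step θ u H γ)
  have hmodel := model_zero_sub_model_step (P := P) hH hγ θ u
  have hen := energy_cgInexactStep hH hγ θ (P.grad u)
  have hlow := le_regularized_energy hH γ (P.step θ u H γ)
  change inner ℝ (P.step θ u H γ) ((H + γ • ContinuousLinearMap.id ℝ (Euc n)) (P.step θ u H γ)) =
    -inner ℝ (P.grad u) (P.step θ u H γ) at hen
  rw [div_le_iff₀ (by linarith)] at hLγ
  rw [hmodel]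
  set q := inner ℝ (P.step θ u H γ)
    ((H + γ • ContinuousLinearMap.id ℝ (Euc n)) (P.step θ u H γ))
  -- Together with `h2`, L‖s‖² ≤ (1-η)q. The descent lemma then gives an actual decrease of at least
  -- (1+η)q/2, against a predicted q/2.
  have h1 : L * ‖P.step θ u H γ‖ ^ 2 ≤ γ * (1 - η) * ‖P.step θ u H γ‖ ^ 2 := by gcongr
  have h2 : (1 - η) * (γ * ‖P.step θ u H γ‖ ^ 2) ≤ (1 - η) * q :=
    mul_le_mul_of_nonneg_left hlow (by linarith)
  nlinarith

/-- If the gradient vanishes, the ratio is `0 / 0`, and the step is rejected. -/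
theorem ratio_step_eq_zero (θ γ : ℝ) (H : Euc n →L[ℝ] Euc n) (hg : P.grad u = 0) :
    P.ratio u H γ (P.step θ u H γ) = 0 := by
  have h0 : cgCount θ γ H (P.grad u) = 0 := by
    refine Nat.sInf_eq_zero.2 (Or.inl ?_)
    simp [IsInexactStep, cgIterate, cgState, hg]
  have : P.step θ u H γ = 0 := by
    rw [step, cgInexactStep, h0]; rfl
  rw [ratio, this]
  simp

end Step

end ImplicitLS

/-! ### Counting iterations -/

/-- A set of naturals all of whose elements have at most `B` predecessors in it has at most
`B + 1` elements. -/
theorem Set.finite_and_ncard_le_of_count_le {S : Set ℕ} [DecidablePred (· ∈ S)] {B : ℝ}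
    (hB : 0 ≤ B) (h : ∀ k ∈ S, (Nat.count (· ∈ S) k : ℝ) ≤ B) :
    S.Finite ∧ (S.ncard : ℝ) ≤ B + 1 := by
  have key : ∀ T : Finset ℕ, (T : Set ℕ) ⊆ S → (T.card : ℝ) ≤ B + 1 := by
    intro T hT
    rcases T.eq_empty_or_nonempty with rfl | hne
    · simp; linarith
    -- All other elements of T precede its maximum, so the hypothesis at the maximum bounds the size
    -- of T.
    · have hmax := T.max'_mem hne
      set k := T.max' hne
      have hsub : T.erase k ⊆ (Finset.range k).filter (· ∈ S) := by
        intro i hi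
        obtain ⟨h1, h2⟩ := Finset.mem_erase.1 hi
        exact Finset.mem_filter.2
          ⟨Finset.mem_range.2 (lt_of_le_of_ne (T.le_max' i h2) h1), hT h2⟩
      have h1 := Finset.card_le_card hsub
      rw [← Nat.count_eq_card_filter_range, Finset.card_erase_of_mem hmax] at h1
      replace h1 : T.card - 1 ≤ Nat.count (· ∈ S) k := h1
      have h2 : T.card ≤ Nat.count (· ∈ S) k + 1 := by omega
      have h3 : (T.card : ℝ) ≤ Nat.count (· ∈ S) k + 1 := by exact_mod_cast h2
      linarith [h k (hT hmax)]
  have hfin : S.Finite := by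
    by_contra hinf
    obtain ⟨T, hT, hcard⟩ := Set.Infinite.exists_subset_card_eq hinf (⌊B + 1⌋₊ + 1)
    have := key T hT
    rw [hcard] at this
    push_cast at this
    linarith [Nat.lt_floor_add_one (B + 1)]
  refine ⟨hfin, ?_⟩
  rw [Set.ncard_eq_toFinset_card S hfin]
  exact key _ (by simp)

namespace ImplicitLS

variable {ny n m p : ℕ} {P : ImplicitLS ny n m p} {L MH η γ0 γmin θ εR εg : ℝ} {u0 : Euc n}
  {H : ℕ → (Euc n →L[ℝ] Euc n)} {u : ℕ → Euc n} {γ : ℕ → ℝ}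

theorem grad_ne_zero_of_not_isEpsPoint {v : Euc n} (hεg : 0 < εg)
    (hv : ¬ P.IsEpsPoint εR εg v) : P.grad v ≠ 0 := by
  intro h
  refine hv (Or.inr ?_)
  rw [h]
  simpa using hεg.le

/-- Off approximate stationary points, the gradient controls the objective. -/
theorem mul_Jhat_le_of_not_isEpsPoint {v : Euc n} (hεR : 0 < εR) (hεg : 0 < εg)
    (hv : ¬ P.IsEpsPoint εR εg v) : 2 * εg ^ 2 * P.Jhat v ≤ ‖P.grad v‖ ^ 2 := by
  rw [IsEpsPoint, not_or, not_le, not_le] at hv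
  have h1 : 0 < ‖P.Rhat v‖ := hεR.trans hv.1
  have h2 := hv.2
  rw [lt_div_iff₀ h1] at h2
  calc 2 * εg ^ 2 * P.Jhat v = (εg * ‖P.Rhat v‖) ^ 2 := by rw [Jhat]; ring
    _ ≤ _ := by gcongr

theorem lt_Jhat_of_not_isEpsPoint {v : Euc n} (hεR : 0 < εR)
    (hv : ¬ P.IsEpsPoint εR εg v) : εR ^ 2 / 2 < P.Jhat v := by
  rw [IsEpsPoint, not_or, not_le] at hv
  have : εR ^ 2 < ‖P.Rhat v‖ ^ 2 := pow_lt_pow_left₀ hv.1 hεR.le two_ne_zero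
  rw [Jhat]
  linarith

namespace IsRun

theorem γmin_le (hrun : P.IsRun η θ γmin γ0 u0 H u γ) (hγmin : 0 < γmin) (hγ0 : γmin ≤ γ0)
    (k : ℕ) : γmin ≤ γ k := by
  induction k with
  | zero => rw [hrun.γ_zero]; exact hγ0
  | succ k ih =>
    by_cases h : η ≤ P.ratio (u k) (H k) (γ k) (P.step θ (u k) (H k) (γ k))
    · rw [(hrun.accept k h).2]; exact le_max_right _ _
    · rw [(hrun.reject k h).2]; linarith

/-- Success means movement, acceptance is decided by the ratio; they agree because a nonzero
gradient yields a nonzero step. -/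
theorem succ_ne_iff (hrun : P.IsRun η θ γmin γ0 u0 H u γ) (hγmin : 0 < γmin) (hγ0 : γmin ≤ γ0)
    (hH : ∀ k, (H k).IsPositive) (hθ : 0 ≤ θ) (hθ1 : θ < 1) {k : ℕ} (hg : P.grad (u k) ≠ 0) :
    u (k + 1) ≠ u k ↔ η ≤ P.ratio (u k) (H k) (γ k) (P.step θ (u k) (H k) (γ k)) := by
  constructor
  · intro h
    by_contra hr
    exact h (hrun.reject k hr).1
  · intro hr
    rw [(hrun.accept k hr).1]
    simpa using step_ne_zero (hH k) (hγmin.trans_le (hrun.γmin_le hγmin hγ0 k)) hθ hθ1 hg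

/-- While the gradient is nonzero, γ doubles only on a rejection, which forces γ < L/(1-η). At a
zero gradient the ratio is 0/0 = 0, every step is rejected and γ grows without bound, hence the
first alternative, which persists. -/
theorem γ_le (hrun : P.IsRun η θ γmin γ0 u0 H u γ) (hP : P.WellPosed)
    (hL : P.LipschitzGradient L) (hη : 0 < η) (hη1 : η < 1) (hγmin : 0 < γmin) (hγ0 : γmin ≤ γ0)
    (hH : ∀ k, (H k).IsPositive) (hθ : 0 ≤ θ) (hθ1 : θ < 1) (k : ℕ) :
    P.grad (u k) = 0 ∨ γ k ≤ max γ0 (2 * (L / (1 - η))) := by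
  induction k with
  | zero => rw [hrun.γ_zero]; exact Or.inr (le_max_left _ _)
  | succ k ih =>
    by_cases hg : P.grad (u k) = 0
    · left
      have : ¬ η ≤ P.ratio (u k) (H k) (γ k) (P.step θ (u k) (H k) (γ k)) := by
        rw [ratio_step_eq_zero θ (γ k) (H k) hg]; exact not_le.2 hη
      rw [(hrun.reject k this).1, hg]
    · right
      have hγk := ih.resolve_left hg
      have hmin := hrun.γmin_le hγmin hγ0 k
      by_cases h : η ≤ P.ratio (u k) (H k) (γ k) (P.step θ (u k) (H k) (γ k))
      · rw [(hrun.accept k h).2]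
        refine max_le ?_ (hγ0.trans (le_max_left _ _))
        rw [show (0.5 : ℝ) = 1 / 2 by norm_num]
        linarith
      · rw [(hrun.reject k h).2]
        refine le_trans ?_ (le_max_right _ _)
        by_contra! hlt
        exact h (hP.le_ratio hL (hH k) hη1 (hγmin.trans_le hmin) (by linarith) hθ hθ1 hg)

theorem mul_predicted_le (hrun : P.IsRun η θ γmin γ0 u0 H u γ) (hγmin : 0 < γmin)
    (hγ0 : γmin ≤ γ0) (hH : ∀ k, (H k).IsPositive) (hθ : 0 ≤ θ) (hθ1 : θ < 1) {k : ℕ}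
    (hg : P.grad (u k) ≠ 0)
    (h : η ≤ P.ratio (u k) (H k) (γ k) (P.step θ (u k) (H k) (γ k))) :
    η * (P.model (u k) (H k) (γ k) 0 -
        P.model (u k) (H k) (γ k) (P.step θ (u k) (H k) (γ k))) ≤
      P.Jhat (u k) - P.Jhat (u (k + 1)) := by
  have hpos := predicted_decrease_pos (hH k) (hγmin.trans_le (hrun.γmin_le hγmin hγ0 k))
    hθ hθ1 hg
  rw [(hrun.accept k h).1]
  rwa [ratio, le_div_iff₀ hpos] at h

theorem Jhat_succ_le (hrun : P.IsRun η θ γmin γ0 u0 H u γ) (hη : 0 < η) (hγmin : 0 < γmin)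
    (hγ0 : γmin ≤ γ0) (hH : ∀ k, (H k).IsPositive) (hθ : 0 ≤ θ) (hθ1 : θ < 1) (k : ℕ) :
    P.Jhat (u (k + 1)) ≤ P.Jhat (u k) := by
  by_cases h : η ≤ P.ratio (u k) (H k) (γ k) (P.step θ (u k) (H k) (γ k))
  · have hg : P.grad (u k) ≠ 0 := by
      intro hg
      rw [ratio_step_eq_zero θ (γ k) (H k) hg] at h
      linarith
    have h1 := predicted_decrease_pos (hH k) (hγmin.trans_le (hrun.γmin_le hγmin hγ0 k))
      hθ hθ1 hg
    have h2 := hrun.mul_predicted_le hγmin hγ0 hH hθ hθ1 hg h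
    have h3 := mul_pos hη h1
    linarith
  · rw [(hrun.reject k h).1]

/-- The reduced objective decreases by a fixed factor in successful iterations. -/
theorem Jhat_succ_le_mul (hrun : P.IsRun η θ γmin γ0 u0 H u γ) (hP : P.WellPosed)
    (hL : P.LipschitzGradient L) (hη : 0 < η) (hη1 : η < 1) (hγmin : 0 < γmin) (hγ0 : γmin ≤ γ0)
    (hMH : ∀ k, ‖H k‖ ≤ MH) (hH : ∀ k, (H k).IsPositive) (hθ : 0 ≤ θ) (hθ1 : θ < 1)
    (hεR : 0 < εR) (hεg : 0 < εg) {k : ℕ} (hk : k ∈ P.successes εR εg u) :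
    P.Jhat (u (k + 1)) ≤
      (1 - η * (1 - θ ^ 2) * εg ^ 2 / (MH + max γ0 (2 * (L / (1 - η))))) * P.Jhat (u k) := by
  obtain ⟨hne, hk⟩ := hk
  have hg := grad_ne_zero_of_not_isEpsPoint hεg hk
  have hγk := hγmin.trans_le (hrun.γmin_le hγmin hγ0 k)
  have hγk' := (hrun.γ_le hP hL hη hη1 hγmin hγ0 hH hθ hθ1 k).resolve_left hg
  have h1 := hrun.mul_predicted_le hγmin hγ0 hH hθ hθ1 hg
    ((hrun.succ_ne_iff hγmin hγ0 hH hθ hθ1 hg).1 hne)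
  have h2 := le_predicted_decrease (P := P) (hH k) hγk hθ (u k)
  have h3 := mul_Jhat_le_of_not_isEpsPoint hεR hεg hk
  have hX : 0 < 1 - θ ^ 2 := by nlinarith
  have hc : 0 < ‖H k‖ + γ k := by positivity
  set Γ := max γ0 (2 * (L / (1 - η)))
  -- Replaces ‖g‖² by its lower bound 2 ε_g² Ĵ and ‖H‖ + γ by its uniform upper bound.
  have h4 : η * (1 - θ ^ 2) * εg ^ 2 / (MH + Γ) * P.Jhat (u k) ≤
      η * ((1 - θ ^ 2) * ‖P.grad (u k)‖ ^ 2 / (2 * (‖H k‖ + γ k))) := by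
    have hJ := P.Jhat_nonneg (u k)
    calc _ ≤ η * (1 - θ ^ 2) * εg ^ 2 / (‖H k‖ + γ k) * P.Jhat (u k) := by
          gcongr
          exact hMH k
      _ = η * ((1 - θ ^ 2) * (2 * εg ^ 2 * P.Jhat (u k)) / (2 * (‖H k‖ + γ k))) := by
          field_simp
      _ ≤ _ := by gcongr
  have h5 := mul_le_mul_of_nonneg_left h2 hη.le
  linarith

-- Iterates the contraction through 1 - c ≤ e^{-c}; since Ĵ ≥ 0, the sign of 1 - c does not matter.
open Classical in
theorem Jhat_le_exp_count (hrun : P.IsRun η θ γmin γ0 u0 H u γ) (hP : P.WellPosed)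
    (hL : P.LipschitzGradient L) (hη : 0 < η) (hη1 : η < 1) (hγmin : 0 < γmin) (hγ0 : γmin ≤ γ0)
    (hMH : ∀ k, ‖H k‖ ≤ MH) (hH : ∀ k, (H k).IsPositive) (hθ : 0 ≤ θ) (hθ1 : θ < 1)
    (hεR : 0 < εR) (hεg : 0 < εg) (k : ℕ) :
    P.Jhat (u k) ≤ Real.exp (-(η * (1 - θ ^ 2) * εg ^ 2 / (MH + max γ0 (2 * (L / (1 - η)))) *
      Nat.count (· ∈ P.successes εR εg u) k)) * P.Jhat u0 := by
  induction k with
  | zero => simp [hrun.u_zero]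
  | succ k ih =>
    rw [Nat.count_succ]
    split_ifs with hk
    · refine (hrun.Jhat_succ_le_mul hP hL hη hη1 hγmin hγ0 hMH hH hθ hθ1 hεR hεg hk).trans ?_
      set c := η * (1 - θ ^ 2) * εg ^ 2 / (MH + max γ0 (2 * (L / (1 - η))))
      have h1 : 1 - c ≤ Real.exp (-c) := by linarith [Real.add_one_le_exp (-c)]
      calc (1 - c) * P.Jhat (u k) ≤ Real.exp (-c) * P.Jhat (u k) :=
            mul_le_mul_of_nonneg_right h1 (P.Jhat_nonneg _)
        _ ≤ Real.exp (-c) * _ := mul_le_mul_of_nonneg_left ih (Real.exp_pos _).le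
        _ = _ := by
          rw [← mul_assoc, ← Real.exp_add]
          push_cast
          ring_nf
    · exact (hrun.Jhat_succ_le hη hγmin hγ0 hH hθ hθ1 k).trans (by simpa using ih)

theorem finite_successes_and_ncard_le (hrun : P.IsRun η θ γmin γ0 u0 H u γ) (hP : P.WellPosed)
    (hL : P.LipschitzGradient L) (hη : 0 < η) (hη1 : η < 1) (hγmin : 0 < γmin) (hγ0 : γmin ≤ γ0)
    (hMH : ∀ k, ‖H k‖ ≤ MH) (hH : ∀ k, (H k).IsPositive) (hθ : 0 ≤ θ) (hθ1 : θ < 1)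
    (hεR : 0 < εR) (hεg : 0 < εg) {J : ℝ} (hJ : P.Jhat u0 ≤ J) :
    (P.successes εR εg u).Finite ∧ ((P.successes εR εg u).ncard : ℝ) ≤
      max 0 (Real.log (2 * J / εR ^ 2)) * ((MH + max γ0 (2 * (L / (1 - η)))) /
        (η * (1 - θ ^ 2) * εg ^ 2)) + 1 := by
  classical
  have hX : 0 < 1 - θ ^ 2 := by nlinarith
  have hM : 0 ≤ MH := (norm_nonneg _).trans (hMH 0)
  have hΓ : 0 < max γ0 (2 * (L / (1 - η))) := (hγmin.trans_le hγ0).trans_le (le_max_left _ _)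
  -- At a success Ĵ still exceeds ε_R²/2, which limits the number of earlier successes. The `max 0`
  -- keeps the bound nonnegative when the logarithm is negative.
  refine Set.finite_and_ncard_le_of_count_le (by positivity) fun k hk => ?_
  have h1 := hrun.Jhat_le_exp_count hP hL hη hη1 hγmin hγ0 hMH hH hθ hθ1 hεR hεg k
  have h2 := lt_Jhat_of_not_isEpsPoint hεR hk.2
  set D := MH + max γ0 (2 * (L / (1 - η)))
  have hD : 0 < D := by positivity
  set N : ℝ := (Nat.count (· ∈ P.successes εR εg u) k : ℝ)
  set c := η * (1 - θ ^ 2) * εg ^ 2 / D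
  have hc0 : 0 < c := by positivity
  have h3 : Real.exp (c * N) ≤ 2 * J / εR ^ 2 := by
    have h4 : εR ^ 2 / 2 ≤ Real.exp (-(c * N)) * J :=
      h2.le.trans (h1.trans (mul_le_mul_of_nonneg_left hJ (Real.exp_pos _).le))
    rw [Real.exp_neg, ← div_eq_inv_mul, le_div_iff₀ (Real.exp_pos _)] at h4
    rw [le_div_iff₀ (by positivity)]
    linarith
  have h5 : c * N ≤ Real.log (2 * J / εR ^ 2) :=
    (Real.le_log_iff_exp_le ((Real.exp_pos _).trans_le h3)).2 h3
  have hinv : D / (η * (1 - θ ^ 2) * εg ^ 2) = c⁻¹ := (inv_div _ _).symm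
  rw [hinv, ← div_eq_mul_inv, le_div_iff₀ hc0, mul_comm]
  exact h5.trans (le_max_right _ _)

/-- Every failure is followed, after boundedly many doublings, by a success. -/
theorem exists_add_mem_successes (hrun : P.IsRun η θ γmin γ0 u0 H u γ) (hP : P.WellPosed)
    (hL : P.LipschitzGradient L) (hη1 : η < 1) (hγmin : 0 < γmin) (hγ0 : γmin ≤ γ0)
    (hH : ∀ k, (H k).IsPositive) (hθ : 0 ≤ θ) (hθ1 : θ < 1)
    (hεg : 0 < εg) {b : ℕ} (hb : L / (1 - η) ≤ 2 ^ b * γmin) {k : ℕ}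
    (hk : ¬ P.IsEpsPoint εR εg (u k)) : ∃ j ≤ b, k + j ∈ P.successes εR εg u := by
  by_contra! hno
  -- Without a success u stays put and γ doubles each time; at i = b it has reached the acceptance
  -- threshold.
  have key : ∀ i ≤ b, u (k + i) = u k ∧ 2 ^ i * γmin ≤ γ (k + i) := by
    intro i
    induction i with
    | zero => intro _; simpa using hrun.γmin_le hγmin hγ0 k
    | succ i ih =>
      intro hi
      obtain ⟨h1, h2⟩ := ih (by omega)
      have hk' : ¬ P.IsEpsPoint εR εg (u (k + i)) := by rwa [h1]
      have heq : u (k + i + 1) = u (k + i) := by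
        by_contra hne
        exact hno i (by omega) ⟨hne, hk'⟩
      have hrej : ¬ η ≤ P.ratio (u (k + i)) (H (k + i)) (γ (k + i))
          (P.step θ (u (k + i)) (H (k + i)) (γ (k + i))) := fun hr =>
        (hrun.succ_ne_iff hγmin hγ0 hH hθ hθ1
          (grad_ne_zero_of_not_isEpsPoint hεg hk')).2 hr heq
      refine ⟨by rw [← add_assoc, heq, h1], ?_⟩
      rw [← add_assoc, (hrun.reject _ hrej).2, pow_succ]
      linarith
  obtain ⟨h1, h2⟩ := key b le_rfl
  have hk' : ¬ P.IsEpsPoint εR εg (u (k + b)) := by rwa [h1]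
  have hg := grad_ne_zero_of_not_isEpsPoint hεg hk'
  exact hno b le_rfl ⟨(hrun.succ_ne_iff hγmin hγ0 hH hθ hθ1 hg).2
    (hP.le_ratio hL (hH _) hη1 (hγmin.trans_le (hrun.γmin_le hγmin hγ0 _)) (hb.trans h2)
      hθ hθ1 hg), hk'⟩

theorem finite_failures_and_ncard_le (hrun : P.IsRun η θ γmin γ0 u0 H u γ) (hP : P.WellPosed)
    (hL : P.LipschitzGradient L) (hη1 : η < 1) (hγmin : 0 < γmin) (hγ0 : γmin ≤ γ0)
    (hH : ∀ k, (H k).IsPositive) (hθ : 0 ≤ θ) (hθ1 : θ < 1)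
    (hεg : 0 < εg) {b : ℕ} (hb : L / (1 - η) ≤ 2 ^ b * γmin)
    (hS : (P.successes εR εg u).Finite) :
    (P.failures εR εg u).Finite ∧
      (P.failures εR εg u).ncard ≤ (b + 1) * (P.successes εR εg u).ncard := by
  -- A failure k is recovered by subtraction from the pair (j, k + j), with k + j a success and j ≤
  -- b; there are (b+1)|S| such pairs.
  have hsub : P.failures εR εg u ⊆
      (fun z : ℕ × ℕ => z.2 - z.1) '' (Set.Iic b ×ˢ P.successes εR εg u) := by
    intro k hk
    obtain ⟨j, hj, hkj⟩ :=
      hrun.exists_add_mem_successes hP hL hη1 hγmin hγ0 hH hθ hθ1 hεg hb hk.2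
    exact ⟨(j, k + j), ⟨hj, hkj⟩, by simp⟩
  have hfin : (Set.Iic b ×ˢ P.successes εR εg u).Finite := (Set.finite_Iic b).prod hS
  refine ⟨(hfin.image _).subset hsub, (Set.ncard_le_ncard hsub (hfin.image _)).trans
    ((Set.ncard_image_le hfin).trans ?_)⟩
  rw [Set.ncard_prod]
  simp [Set.ncard_eq_toFinset_card']

theorem exists_first_isEpsPoint (hS : (P.successes εR εg u).Finite)
    (hU : (P.failures εR εg u).Finite) :
    ∃ K : ℕ, P.IsEpsPoint εR εg (u K) ∧ ∀ k < K, ¬ P.IsEpsPoint εR εg (u k) := by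
  classical
  have hex : ∃ K : ℕ, P.IsEpsPoint εR εg (u K) := by
    by_contra! hno
    refine Set.infinite_univ (α := ℕ) ((hS.union hU).subset fun k _ => ?_)
    by_cases h : u (k + 1) = u k
    · exact Or.inr ⟨h, hno k⟩
    · exact Or.inl ⟨h, hno k⟩
  exact ⟨Nat.find hex, Nat.find_spec hex, fun k hk => Nat.find_min hex hk⟩

end IsRun

theorem sum_filter_le_mul_ncard_successes {f : ℕ → ℕ} {K N : ℕ}
    (hS : (P.successes εR εg u).Finite) (hK : ∀ k < K, ¬ P.IsEpsPoint εR εg (u k))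
    (hf : ∀ k < K, f k ≤ N) :
    ∑ k ∈ (Finset.range K).filter (fun k => u (k + 1) ≠ u k), f k ≤
      N * (P.successes εR εg u).ncard := by
  have hcard : ((Finset.range K).filter (fun k => u (k + 1) ≠ u k)).card ≤
      (P.successes εR εg u).ncard := by
    rw [← Set.ncard_coe_finset]
    refine Set.ncard_le_ncard (fun k hk => ?_) hS
    obtain ⟨h1, h2⟩ := Finset.mem_filter.1 hk
    exact ⟨h2, hK k (Finset.mem_range.1 h1)⟩
  calc _ ≤ ((Finset.range K).filter (fun k => u (k + 1) ≠ u k)).card • N :=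
        Finset.sum_le_card_nsmul _ _ _ fun k hk =>
          hf k (Finset.mem_range.1 (Finset.mem_filter.1 hk).1)
    _ ≤ _ := by rw [smul_eq_mul, mul_comm]; exact Nat.mul_le_mul_left _ hcard

theorem sum_le_mul_ncard_add_ncard {f : ℕ → ℕ} {K N : ℕ}
    (hS : (P.successes εR εg u).Finite) (hU : (P.failures εR εg u).Finite)
    (hK : ∀ k < K, ¬ P.IsEpsPoint εR εg (u k)) (hf : ∀ k < K, f k ≤ N) :
    ∑ k ∈ Finset.range K, f k ≤
      N * ((P.successes εR εg u).ncard + (P.failures εR εg u).ncard) := by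
  have hcard : K ≤ (P.successes εR εg u).ncard + (P.failures εR εg u).ncard := by
    refine le_trans ?_ (Set.ncard_union_le _ _)
    conv_lhs => rw [← Finset.card_range K, ← Set.ncard_coe_finset]
    refine Set.ncard_le_ncard (fun k hk => ?_) (hS.union hU)
    have hk' := hK k (Finset.mem_range.1 hk)
    by_cases h : u (k + 1) = u k
    · exact Or.inr ⟨h, hk'⟩
    · exact Or.inl ⟨h, hk'⟩
  calc _ ≤ (Finset.range K).card • N :=
        Finset.sum_le_card_nsmul _ _ _ fun k hk => hf k (Finset.mem_range.1 hk)
    _ ≤ _ := by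
      rw [smul_eq_mul, mul_comm, Finset.card_range]; exact Nat.mul_le_mul_left _ hcard

end ImplicitLS

/-! ### Absorbing constants into the asymptotic bound -/

section Constants

variable {L MH η θ γ0 γmin θ₀ : ℝ}

theorem div_le_kappaIn (hγmin : 0 < γmin) :
    (MH + γ0) / γmin ≤ kappaIn L MH η θ γ0 γmin := by
  rw [kappaIn, gammaMaxIn]
  gcongr
  exact (le_max_left _ _).trans (le_max_right _ _)

theorem one_lt_kappaIn (hMH : 0 < MH) (hγmin : 0 < γmin) (hγ0 : γmin ≤ γ0) :
    1 < kappaIn L MH η θ γ0 γmin := by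
  refine lt_of_lt_of_le ?_ (div_le_kappaIn hγmin)
  rw [one_lt_div hγmin]
  linarith

/-- The condition number of the regularized matrix is at most `κ`. -/
theorem add_le_kappaIn_mul {γ h : ℝ} (hMH : 0 < MH) (hγmin : 0 < γmin) (hγ0 : γmin ≤ γ0)
    (hγ : γmin ≤ γ) (hh : h ≤ MH) : h + γ ≤ kappaIn L MH η θ γ0 γmin * γ := by
  have h1 : (MH + γ0) / γmin * γ ≤ kappaIn L MH η θ γ0 γmin * γ :=
    mul_le_mul_of_nonneg_right (div_le_kappaIn hγmin) (by linarith)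
  refine le_trans ?_ h1
  -- The condition number 1 + h/γ needs only the lower bound on γ, so no upper bound enters.
  rw [div_mul_eq_mul_div, le_div_iff₀ hγmin]
  nlinarith

/-- The lower bound κ₀ > 1 keeps log(κ/θ) above log κ₀, so both log 2 and the rounding of the
ceiling are absorbed into multiples of √κ log(κ/θ). -/
theorem cgBound_le {κ₀ κ : ℝ} (n : ℕ) (hκ₀ : 1 < κ₀) (hκ : κ₀ ≤ κ) (hθ : 0 < θ) (hθ1 : θ < 1) :
    (cgBound n κ θ : ℝ) ≤ (1 + 1 / 2 * (Real.log 2 / Real.log κ₀ + 1) + 1 / Real.log κ₀) *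
      min (n : ℝ) (√κ * Real.log (κ / θ)) := by
  have hl₀ : 0 < Real.log κ₀ := Real.log_pos hκ₀
  have hκ0 : 0 < κ := by linarith
  have hs : 1 ≤ √κ := Real.one_le_sqrt.2 (by linarith)
  have hl : Real.log κ₀ ≤ Real.log (κ / θ) := by
    refine Real.log_le_log (by linarith) ?_
    rw [le_div_iff₀ hθ]
    nlinarith
  have hl2 : 0 < Real.log 2 := Real.log_pos (by norm_num)
  have hlog : Real.log (2 * κ / θ) = Real.log 2 + Real.log (κ / θ) := by
    rw [mul_div_assoc, Real.log_mul two_ne_zero (by positivity)]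
  rw [cgBound, if_neg hθ.ne', Nat.cast_min]
  set l := Real.log (κ / θ) with hldef
  set l₀ := Real.log κ₀ with hl₀def
  have hl0 : 0 < l := hl₀.trans_le hl
  set y := √κ * l with hy
  have hy0 : l₀ ≤ y := by nlinarith
  set a := Real.log 2 / l₀ with ha
  have ha0 : 0 < a := by positivity
  have hceil := (Nat.ceil_lt_add_one (a := 1 / 2 * √κ * Real.log (2 * κ / θ))
    (by rw [hlog]; positivity)).le
  have h1 : Real.log 2 ≤ a * l := by
    rw [ha, div_mul_eq_mul_div, le_div_iff₀ hl₀]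
    gcongr
  have h2 : 1 ≤ 1 / l₀ * y := by
    rw [one_div_mul_eq_div, le_div_iff₀ hl₀, one_mul]; exact hy0
  have h3 : 1 / 2 * √κ * Real.log (2 * κ / θ) ≤ 1 / 2 * (a + 1) * y := by
    rw [hlog, hy]
    calc 1 / 2 * √κ * (Real.log 2 + l) ≤ 1 / 2 * √κ * (a * l + l) := by gcongr
      _ = _ := by ring
  have hC1 : 1 ≤ 1 + 1 / 2 * (a + 1) + 1 / l₀ := by
    have : 0 < 1 / l₀ := by positivity
    linarith
  rw [mul_min_of_nonneg _ _ (by linarith)]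
  refine min_le_min ?_ ?_
  · exact le_mul_of_one_le_left (Nat.cast_nonneg n) hC1
  · have : 0 < y := hl₀.trans_le hy0
    nlinarith

/-- Bound for the number of iterations in terms of the tolerances. -/
theorem iterations_le {J D εbar εR εg S U B : ℝ} (hJ : 1 ≤ J) (hD : 0 ≤ D) (hη : 0 < η)
    (hB : 0 ≤ B) (hθ₀ : 0 < θ₀) (hθ₀1 : θ₀ < 1) (hθ : θ₀ ≤ θ) (hθ1 : θ < 1)
    (hεbar1 : εbar < 1) (hεR : 0 < εR) (hεR' : εR ≤ εbar) (hεg : 0 < εg) (hεg1 : εg < 1)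
    (hS : S ≤ max 0 (Real.log (2 * J / εR ^ 2)) * (D / (η * (1 - θ ^ 2) * εg ^ 2)) + 1)
    (hU : U ≤ B * S) :
    1 + S + U ≤ (((2 + B) / Real.log (εbar⁻¹) +
        (1 + B) * (Real.log (2 * J) / Real.log (εbar⁻¹) + 2) * (D / η)) /
          Real.log (1 / (1 - θ₀ ^ 2))) *
      (Real.log (1 / (1 - θ ^ 2)) * (1 / (1 - θ ^ 2) ^ 2) * Real.log (εR⁻¹) *
        (1 / εg ^ 2)) := by
  have hεbar : 0 < εbar := hεR.trans_le hεR'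
  have hX : 0 < 1 - θ ^ 2 := by nlinarith
  have hX1 : 1 - θ ^ 2 ≤ 1 := by nlinarith
  have hX₀ : 0 < 1 - θ₀ ^ 2 := by nlinarith
  have hXX₀ : 1 - θ ^ 2 ≤ 1 - θ₀ ^ 2 := by nlinarith
  have hd₀ : 0 < Real.log (1 / (1 - θ₀ ^ 2)) :=
    Real.log_pos (by rw [one_lt_div hX₀]; nlinarith)
  have hd : Real.log (1 / (1 - θ₀ ^ 2)) ≤ Real.log (1 / (1 - θ ^ 2)) :=
    Real.log_le_log (by positivity) (by gcongr)
  have hl₀ : 0 < Real.log (εbar⁻¹) := Real.log_pos ((one_lt_inv₀ hεbar).2 hεbar1)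
  have hl : Real.log (εbar⁻¹) ≤ Real.log (εR⁻¹) :=
    Real.log_le_log (by positivity) (by gcongr)
  have hj : 0 < Real.log (2 * J) := Real.log_pos (by linarith)
  have hJ0 : 0 < J := by linarith
  have hlog : Real.log (2 * J / εR ^ 2) = Real.log (2 * J) + 2 * Real.log (εR⁻¹) := by
    rw [div_eq_mul_inv, Real.log_mul (by positivity) (by positivity), ← inv_pow, Real.log_pow]
    norm_num
  rw [hlog, max_eq_right (by linarith)] at hS
  set X := 1 - θ ^ 2
  set d₀ := Real.log (1 / (1 - θ₀ ^ 2))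
  set d := Real.log (1 / X)
  set l₀ := Real.log (εbar⁻¹)
  set l := Real.log (εR⁻¹)
  set j := Real.log (2 * J)
  have hl0 : 0 < l := hl₀.trans_le hl
  have hd0 : 0 < d := hd₀.trans_le hd
  set Z := l / (X * εg ^ 2) with hZ
  have hXε : X * εg ^ 2 ≤ 1 := mul_le_one₀ hX1 (by positivity) (pow_le_one₀ hεg.le hεg1.le)
  have hZl : l ≤ Z := by
    rw [hZ, le_div_iff₀ (by positivity)]
    exact mul_le_of_le_one_right hl0.le hXε
  have h1 : 1 ≤ 1 / l₀ * Z := by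
    rw [one_div_mul_eq_div, le_div_iff₀ hl₀, one_mul]; exact hl.trans hZl
  have h2 : (j + 2 * l) * (D / (η * X * εg ^ 2)) ≤ (j / l₀ + 2) * (D / η) * Z := by
    have : j ≤ j / l₀ * l := by
      rw [div_mul_eq_mul_div, le_div_iff₀ hl₀]; gcongr
    calc (j + 2 * l) * (D / (η * X * εg ^ 2))
        ≤ (j / l₀ * l + 2 * l) * (D / (η * X * εg ^ 2)) := by gcongr
      _ = _ := by rw [hZ]; field_simp
  have h3 : 1 + S + U ≤ ((2 + B) / l₀ + (1 + B) * (j / l₀ + 2) * (D / η)) * Z := by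
    have h4 : (1 + B) * S ≤ (1 + B) * ((j / l₀ + 2) * (D / η) * Z + 1) :=
      mul_le_mul_of_nonneg_left (by linarith) (by linarith)
    have h5 : (2 + B) * 1 ≤ (2 + B) * (1 / l₀ * Z) :=
      mul_le_mul_of_nonneg_left h1 (by linarith)
    have h6 : ((2 + B) / l₀ + (1 + B) * (j / l₀ + 2) * (D / η)) * Z =
        (2 + B) * (1 / l₀ * Z) + (1 + B) * ((j / l₀ + 2) * (D / η) * Z) := by ring
    linarith
  -- The only place where the bound is weakened to the stated powers of 1 - θ², using X ≤ 1 and d₀ ≤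
  -- d.
  have h7 : Z ≤ 1 / d₀ * (d * (1 / X ^ 2) * l * (1 / εg ^ 2)) := by
    have hXinv : 1 / X ≤ 1 / X ^ 2 := by
      apply one_div_le_one_div_of_le (by positivity)
      nlinarith
    rw [one_div_mul_eq_div, le_div_iff₀ hd₀]
    calc Z * d₀ = d₀ * (1 / X) * l * (1 / εg ^ 2) := by rw [hZ]; field_simp
      _ ≤ _ := by gcongr
  calc _ ≤ ((2 + B) / l₀ + (1 + B) * (j / l₀ + 2) * (D / η)) * Z := h3
    _ ≤ ((2 + B) / l₀ + (1 + B) * (j / l₀ + 2) * (D / η)) *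
        (1 / d₀ * (d * (1 / X ^ 2) * l * (1 / εg ^ 2))) := by gcongr
    _ = _ := by ring

end Constants
-- The complexity bound
theorem corollary3
    (L MH η γ0 γmin J0 θ₀ εbar : ℝ)
    (hL : 0 < L) (hMH : 0 < MH) (hη : 0 < η) (hη1 : η < 1)
    (hγmin : 0 < γmin) (hγ0 : γmin ≤ γ0)
    (hθ₀ : 0 < θ₀) (hθ₀1 : θ₀ < 1) (hεbar : 0 < εbar) (hεbar1 : εbar < 1) :
    ∃ C : ℝ, 0 < C ∧
      ∀ (ny n m p : ℕ) (P : ImplicitLS ny n m p) (u0 : Euc n) (θ εR εg : ℝ)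
        (H : ℕ → (Euc n →L[ℝ] Euc n)) (u : ℕ → Euc n) (γ : ℕ → ℝ),
        P.WellPosed → P.LipschitzGradient L → P.Jhat u0 ≤ J0 →
        0 ≤ θ → θ < 1 → 0 < εR → 0 < εg → εg < 1 →
        (∀ k, ‖H k‖ ≤ MH) → (∀ k, (H k).IsPositive) →
        P.IsRun η θ γmin γ0 u0 H u γ →
        (P.successes εR εg u).Finite ∧ (P.failures εR εg u).Finite ∧
        (∃ K : ℕ,
          P.IsEpsPoint εR εg (u K) ∧ (∀ k < K, ¬ P.IsEpsPoint εR εg (u k)) ∧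
          (∀ k < K, IsInexactStep θ (γ k) (H k) (P.grad (u k))
              (P.step θ (u k) (H k) (γ k)) ∧
            P.products θ H u γ k ≤ cgBound n (kappaIn L MH η θ γ0 γmin) θ) ∧
          (∑ k ∈ (Finset.range K).filter (fun k => u (k + 1) ≠ u k), P.products θ H u γ k ≤
            cgBound n (kappaIn L MH η θ γ0 γmin) θ *
              (1 + (P.successes εR εg u).ncard)) ∧
          (∑ k ∈ Finset.range K, P.products θ H u γ k ≤
            cgBound n (kappaIn L MH η θ γ0 γmin) θ *
              (1 + (P.successes εR εg u).ncard + (P.failures εR εg u).ncard))) ∧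
        (θ₀ ≤ θ → εR ≤ εbar →
          ((cgBound n (kappaIn L MH η θ γ0 γmin) θ *
              (1 + (P.successes εR εg u).ncard + (P.failures εR εg u).ncard) : ℕ) : ℝ) ≤
            C * (min (n : ℝ) (√(kappaIn L MH η θ γ0 γmin) *
                Real.log (kappaIn L MH η θ γ0 γmin / θ)) *
              Real.log (1 / (1 - θ ^ 2)) * (1 / (1 - θ ^ 2) ^ 2) *
              Real.log (εR⁻¹) * (1 / εg ^ 2))) := by
  -- Number of doublings from γ_min to the acceptance threshold; it depends only on L, η and γ_min,
  -- so it may enter C.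
  obtain ⟨b, hb⟩ : ∃ b : ℕ, L / (1 - η) ≤ 2 ^ b * γmin := by
    obtain ⟨b, hb⟩ := pow_unbounded_of_one_lt (L / (1 - η) / γmin) (one_lt_two (α := ℝ))
    exact ⟨b, ((div_lt_iff₀ hγmin).1 hb).le⟩
  have hγ0pos : 0 < γ0 := hγmin.trans_le hγ0
  have hκ₀ : 1 < (MH + γ0) / γmin := by
    rw [one_lt_div hγmin]; linarith
  set D := MH + max γ0 (2 * (L / (1 - η))) with hDdef
  have hD : 0 < D := add_pos hMH (hγ0pos.trans_le (le_max_left _ _))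
  set C₁ := 1 + 1 / 2 * (Real.log 2 / Real.log ((MH + γ0) / γmin) + 1) +
    1 / Real.log ((MH + γ0) / γmin) with hC₁def
  -- The constant of `iterations_le` with B = b + 1; J₀ is raised to at least 1 so that log(2J) is
  -- positive.
  set C₂ := ((2 + ((b : ℝ) + 1)) / Real.log (εbar⁻¹) + (1 + ((b : ℝ) + 1)) *
    (Real.log (2 * max 1 J0) / Real.log (εbar⁻¹) + 2) * (D / η)) /
      Real.log (1 / (1 - θ₀ ^ 2)) with hC₂def
  have hC₁ : 0 < C₁ := by
    have h1 := Real.log_pos hκ₀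
    have h2 := Real.log_pos (one_lt_two (α := ℝ))
    positivity
  have hC₂ : 0 < C₂ := by
    have h1 : 0 < Real.log (εbar⁻¹) := Real.log_pos ((one_lt_inv₀ hεbar).2 hεbar1)
    have h2 : 0 < Real.log (2 * max 1 J0) :=
      Real.log_pos (by linarith [le_max_left 1 J0])
    have hX₀ : 0 < 1 - θ₀ ^ 2 := by nlinarith
    have h3 : 0 < Real.log (1 / (1 - θ₀ ^ 2)) :=
      Real.log_pos (by rw [one_lt_div hX₀]; nlinarith)
    positivity
  refine ⟨C₁ * C₂, mul_pos hC₁ hC₂, ?_⟩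
  intro ny n m p P u0 θ εR εg H u γ hP hL' hJ hθ hθ1 hεR hεg hεg1 hMHk hH hrun
  obtain ⟨hS, hScard⟩ := hrun.finite_successes_and_ncard_le hP hL' hη hη1 hγmin hγ0 hMHk hH hθ hθ1
    hεR hεg (hJ.trans (le_max_right 1 J0))
  obtain ⟨hU, hUcard⟩ := hrun.finite_failures_and_ncard_le hP hL' hη1 hγmin hγ0 hH hθ hθ1
    (εR := εR) hεg hb hS
  have hγk : ∀ k, γmin ≤ γ k := hrun.γmin_le hγmin hγ0
  have hprod : ∀ k, P.products θ H u γ k ≤ cgBound n (kappaIn L MH η θ γ0 γmin) θ := by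
    intro k
    have h := cgCount_le_cgBound (hH k) (hγmin.trans_le (hγk k))
      (one_lt_kappaIn (L := L) (η := η) (θ := θ) hMH hγmin hγ0)
      (add_le_kappaIn_mul hMH hγmin hγ0 (hγk k) (hMHk k)) hθ (P.grad (u k))
    rwa [finrank_euclideanSpace_fin] at h
  refine ⟨hS, hU, ?_, ?_⟩
  · obtain ⟨K, hK, hKmin⟩ := ImplicitLS.IsRun.exists_first_isEpsPoint hS hU
    refine ⟨K, hK, hKmin, fun k _ => ⟨?_, hprod k⟩, ?_, ?_⟩
    · exact isInexactStep_cgInexactStep (hH k) (hγmin.trans_le (hγk k)) hθ _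
    · exact (ImplicitLS.sum_filter_le_mul_ncard_successes hS hKmin fun k _ => hprod k).trans
        (Nat.mul_le_mul_left _ (by omega))
    · exact (ImplicitLS.sum_le_mul_ncard_add_ncard hS hU hKmin fun k _ => hprod k).trans
        (Nat.mul_le_mul_left _ (by omega))
  · intro hθ' hεR'
    have hUcard' : ((P.failures εR εg u).ncard : ℝ) ≤
        ((b : ℝ) + 1) * ((P.successes εR εg u).ncard : ℝ) := by exact_mod_cast hUcard
    have h1 := cgBound_le n hκ₀ (div_le_kappaIn (L := L) (MH := MH) (η := η) (θ := θ) (γ0 := γ0)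
      hγmin) (hθ₀.trans_le hθ') hθ1
    have h2 := iterations_le (le_max_left 1 J0) hD.le hη (B := (b : ℝ) + 1) (by positivity)
      hθ₀ hθ₀1 hθ' hθ1 hεbar1 hεR hεR' hεg hεg1 hScard hUcard'
    rw [← hC₁def] at h1
    rw [← hC₂def] at h2
    push_cast
    have h3 := mul_le_mul h1 h2 (by positivity) ((Nat.cast_nonneg _).trans h1)
    refine h3.trans (le_of_eq ?_)
    ring
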